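/- For $x\in\{0,1,2,\dots\}$ and $q\in[0,1]$ put $h(x,q)=1-(1-q)^{(x-1)_+}$, where $(a)_+=\max\{a,0\}$ and $0^0:=1$. Let $m=m(n)\ge 1$ be integers with $m\to\infty$ as $n\to\infty$. For each $n$ let $(X_{n,1},Q_{n,1}),\dots,(X_{n,m},Q_{n,m})$ be independent (not necessarily identically distributed) random pairs with values in $\{0,1,\dots,n\}\times[0,1]$. Let $G_{n,1},\dots,G_{n,m}$ be independent random graphs defined as follows: first $(X_{n,i},Q_{n,i})$ is sampled; given this pair, a vertex set $\mathcal V_{n,i}\subset[n]$ of size $X_{n,i}$ is chosen uniformly at random, and then every pair of distinct elements of $\mathcal V_{n,i}$ is linked by an edge independently with probability $Q_{n,i}$. The community affiliation graph $G_{[n,m]}$ is the graph on the vertex set $[n]$ whose edge set is the union of the edge sets of $G_{n,1},\dots,G_{n,m}$. Let $i_*$ be uniformly distributed on $[m]$ and independent of the pairs, so that the law of $(X_{n,i_*},Q_{n,i_*})$ is the average of the laws of $(X_{n,i},Q_{n,i})$, $i\in[m]$. Put $$\kappa_n=\mathbf E\bigl(X_{n,i_*}h(X_{n,i_*},Q_{n,i_*})\bigr),\qquad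 \lambda_{n,m}=\ln n-\frac mn\,\kappa_n .$$ Assume that, as $n\to\infty$, $(X_{n,i_*},Q_{n,i_*})$ converges in distribution to a random pair $(X,Q)$ with values in $\{0,1,2,\dots\}\times[0,1]$ such that $\mathbf E\bigl(Q\,\mathbb I_{\{X\ge 2\}}\bigr)>0$ and $\mathbf E\bigl(X\,h(X,Q)\ln(1+X)\bigr)<\infty$, and that $$\mathbf E\bigl(X_{n,i_*}h(X_{n,i_*},Q_{n,i_*})\ln(1+X_{n,i_*})\bigr)\to\mathbf E\bigl(X\,h(X,Q)\ln(1+X)\bigr).$$ Then $\mathbf P\{G_{[n,m]}\text{ is connected}\}\to 0$ if $\lambda_{n,m}\to+\infty$, and $\mathbf P\{G_{[n,m]}\text{ is connected}\}\to 1$ if $\lambda_{n,m}\to-\infty$. -/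

import Mathlib

open MeasureTheory ProbabilityTheory Filter Topology

noncomputable section

namespace CommunityAffiliation

/-- The state space of a pair (community size, edge density). -/
abbrev Params : Type := ℕ × unitInterval

instance instMeasurableSingletonClassSimpleGraph (n : ℕ) :
    MeasurableSingletonClass (SimpleGraph (Fin n)) := by
  refine ⟨fun G => ?_⟩
  have h : ({G} : Set (SimpleGraph (Fin n))) =
      SimpleGraph.edgeSet ⁻¹' ({G.edgeSet} : Set (Set (Sym2 (Fin n)))) := by
    ext H
    simp
  rw [h]
  exact SimpleGraph.measurable_edgeSet (measurableSet_singleton _)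

/-- The pairs of distinct elements of the vertex subset `V` (the edges of the complete graph
on `V`). -/
def pairsIn {n : ℕ} (V : Finset (Fin n)) : Set (Sym2 (Fin n)) :=
  {e | ¬ e.IsDiag ∧ ∀ v ∈ e, v ∈ V}

/-- The law of the Bernoulli random graph on the vertex subset `V ⊆ [n]` with edge density `q`,
seen as a graph on `[n]`: every pair of distinct elements of `V` is an edge independently with
probability `q`, and there are no other edges. -/
def bernoulliGraph {n : ℕ} (V : Finset (Fin n)) (q : unitInterval) :
    Measure (SimpleGraph (Fin n)) :=
  (setBernoulli (pairsIn V) q).map SimpleGraph.fromEdgeSet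

/-- The conditional law of a community (layer), given that its size and density are `p = (x, q)`:
a vertex set `V ⊆ [n]` of size `x` is chosen uniformly at random and, given `V`, a Bernoulli
random graph of density `q` is sampled on `V`. -/
def layerGiven (n : ℕ) (p : Params) : Measure (SimpleGraph (Fin n)) :=
  (uniformOn {V : Finset (Fin n) | V.card = p.1}).bind (fun V => bernoulliGraph V p.2)

lemma measurable_bernoulliGraph {n : ℕ} (V : Finset (Fin n)) :
    Measurable (fun q : unitInterval => bernoulliGraph V q) := by
  have hset : ∀ S : Set (Set (Sym2 (Fin n))),
      Measurable (fun q : unitInterval => setBernoulli (pairsIn V) q S) := by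
    intro S
    have h1 : ∀ q : unitInterval, setBernoulli (pairsIn V) q S =
        ∑ s ∈ S.toFinite.toFinset, setBernoulli (pairsIn V) q {s} := by
      intro q
      rw [sum_measure_singleton]
      simp
    simp_rw [h1]
    refine Finset.measurable_sum _ fun s _ => ?_
    by_cases hs : s ⊆ pairsIn V
    · simp_rw [setBernoulli_singleton _ hs (Set.toFinite _)]
      have hc1 : Continuous (fun q : unitInterval => unitInterval.toNNReal q) := by fun_prop
      have hc2 : Continuous (fun q : unitInterval =>
        unitInterval.toNNReal (unitInterval.symm q)) := by fun_prop
      exact (hc1.measurable.coe_nnreal_ennreal.pow_const _).mul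
        (hc2.measurable.coe_nnreal_ennreal.pow_const _)
    · simp_rw [setBernoulli_singleton_of_not_subset _ hs]
      exact measurable_const
  refine Measure.measurable_of_measurable_coe _ fun S hS => ?_
  simp_rw [bernoulliGraph, Measure.map_apply SimpleGraph.measurable_fromEdgeSet hS]
  exact hset _

lemma measurable_layerGiven (n : ℕ) : Measurable (layerGiven n) := by
  refine measurable_from_prod_countable_right fun x => ?_
  refine Measure.measurable_of_measurable_coe _ fun S hS => ?_
  simp_rw [layerGiven, Measure.bind_apply hS (Measurable.of_discrete).aemeasurable,
    lintegral_fintype]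
  exact Finset.measurable_sum _ fun V _ =>
    ((Measure.measurable_coe hS).comp (measurable_bernoulliGraph V)).mul_const _

/-- `layerGiven` as a measurable kernel from pairs (size, density) to graphs on `[n]`. -/
def layerKernel (n : ℕ) : Kernel Params (SimpleGraph (Fin n)) where
  toFun := layerGiven n
  measurable' := measurable_layerGiven n

/-- The law of a community whose random pair (size, density) has law `μ`: first the pair is
sampled from `μ`, then the community is sampled given the pair. -/
def layerLaw (n : ℕ) (μ : Measure Params) : Measure (SimpleGraph (Fin n)) :=
  μ.bind (layerKernel n)

/-- The law of the community affiliation graph on `[n]`: the union of `m` independent communities,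
the `i`-th of which is defined by a random pair (size, density) with law `μ i`. -/
def affiliationLaw (n : ℕ) {m : ℕ} (μ : Fin m → ProbabilityMeasure Params) :
    Measure (SimpleGraph (Fin n)) :=
  (Measure.pi fun i => layerLaw n (μ i : Measure Params)).map (fun G => ⨆ i, G i)

/-- The probability that the community affiliation graph is connected. -/
def probConnected (n : ℕ) {m : ℕ} (μ : Fin m → ProbabilityMeasure Params) : ℝ :=
  (affiliationLaw n μ).real {G | G.Connected}

/-- The law of the pair with uniformly random index `i_* ∈ [m]`, independent of the pairs:
the average of the laws `μ i`. -/
def averagedLaw {m : ℕ} [NeZero m] (μ : Fin m → ProbabilityMeasure Params) :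
    ProbabilityMeasure Params :=
  ⟨(m : ENNReal)⁻¹ • ∑ i, (μ i : Measure Params), ⟨by
    simp only [Measure.smul_apply, Measure.finsetSum_apply, measure_univ, smul_eq_mul]
    simp only [Finset.sum_const, Finset.card_univ, Fintype.card_fin, nsmul_eq_mul, mul_one]
    exact ENNReal.inv_mul_cancel (by simp [NeZero.ne m]) (by simp)⟩⟩

/-- `h(x, q) = 1 - (1 - q)^{(x - 1)₊}`, with `0 ^ 0 = 1`; the subtraction in the exponent is the
truncated one. -/
def h (p : Params) : ℝ := 1 - (1 - (p.2 : ℝ)) ^ (p.1 - 1)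

/-- The mean of `X h(X, Q)` for a pair `(X, Q)` with law `μ`. -/
def kappa (μ : Measure Params) : ℝ := ∫ p, (p.1 : ℝ) * h p ∂μ

/-- `λ_{n,m} = ln n - (m / n) κ_n`. -/
def lambda (n : ℕ) {m : ℕ} [NeZero m] (μ : Fin m → ProbabilityMeasure Params) : ℝ :=
  Real.log n - (m : ℝ) / n * kappa (averagedLaw μ : Measure Params)

end CommunityAffiliation

end

open CommunityAffiliation

namespace CommunityAffiliation

/-! Given its size and density, a layer isolates a fixed vertex with probability `1 - X h(X, Q) /
n`. The union isolates it with probability about `exp (-m κ / n)`, so the expected number of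
isolated vertices is about `exp λ`. Isolated vertices turn out to be the decisive obstruction to
connectedness. The tool throughout is that a union has no edge leaving `S` (`uncrossed S`) exactly
when every layer has none, so that independence turns the probability into a product
(`affiliationLaw_real_eq_prod`).

If `λ → +∞`, the second moment method produces an isolated vertex (`probConnected_le`). All errors
are governed by `D = (m / n ^ 2) E (X ^ 2 h)`, which tends to `0` (`integral_fst_sq_mul_h_le`).

If `λ → -∞`, a disconnected graph has an uncrossed `S` with `1 ≤ |S| ≤ n / 2`, and a union bound
over such `S` suffices (`one_sub_probConnected_le_exp`). For `|S| ≤ n ^ (1 - 2 δ)` a layer of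
moderate size rarely meets `S` twice, so the cut probability is nearly `exp (-m κ / n) ^ |S|`, which
beats the at most `n ^ |S|` choices. For larger `S` the number of choices is only `(e n ^ (2 δ)) ^
|S|`, and a crude bound using one potential edge per layer is enough.

Since `m κ / n` is compared with `ln n`, an error in `κ` must be `o(1 / ln n)`. This is what the
logarithmic moment provides: with convergence in distribution it gives uniform integrability
(`tendsto_integral_logWeightTail`), so sizes above a power of `n` contribute `o(1 / ln n)` to `κ`.
-/

/-! ### Bernoulli graphs on a fixed vertex set -/

lemma setBernoulli_real_disjoint {ι : Type*} (u : Set ι) (q : unitInterval) (e : Finset ι)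
    [DecidablePred (· ∈ u)] :
    (setBernoulli u q).real {T | ∀ i ∈ e, i ∉ T} = (1 - (q : ℝ)) ^ (e.filter (· ∈ u)).card := by
  rw [measureReal_def, setBernoulli_apply']
  have hpre : (fun p : ι → Prop => {i | p i}) ⁻¹' {T : Set ι | ∀ i ∈ e, i ∉ T} =
      Set.pi (e : Set ι) fun _ => {False} := by
    ext f
    simp
  rw [hpre, Measure.infinitePi_pi _ (fun i _ => measurableSet_singleton _), ENNReal.toReal_prod,
    Finset.card_filter, ← Finset.prod_pow_eq_pow_sum]
  refine Finset.prod_congr rfl fun i _ => ?_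
  by_cases hi : i ∈ u
  · simp [hi]
  · simp [hi, ← ENNReal.coe_add]

/-- The graphs without edges between the vertex set `S` and its complement. -/
def uncrossed {n : ℕ} (S : Finset (Fin n)) : Set (SimpleGraph (Fin n)) :=
  {G | ∀ u ∈ S, ∀ w ∉ S, ¬ G.Adj u w}

instance {n : ℕ} (V : Finset (Fin n)) (q : unitInterval) :
    IsProbabilityMeasure (bernoulliGraph V q) :=
  Measure.isProbabilityMeasure_map SimpleGraph.measurable_fromEdgeSet.aemeasurable

lemma bernoulliGraph_real_avoid {n : ℕ} (V : Finset (Fin n)) (q : unitInterval)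
    (e : Finset (Sym2 (Fin n))) (he : ∀ i ∈ e, ¬ i.IsDiag) [DecidablePred (· ∈ pairsIn V)] :
    (bernoulliGraph V q).real {G | ∀ i ∈ e, i ∉ G.edgeSet} =
      (1 - (q : ℝ)) ^ (e.filter (· ∈ pairsIn V)).card := by
  rw [bernoulliGraph, map_measureReal_apply SimpleGraph.measurable_fromEdgeSet
    (Set.toFinite _).measurableSet, ← setBernoulli_real_disjoint]
  congr 1
  ext T
  simp only [Set.mem_preimage, SimpleGraph.edgeSet_fromEdgeSet, Set.mem_ofPred_eq]
  refine forall₂_congr fun i hi => ?_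
  simp [he i hi]

lemma bernoulliGraph_real_star {n : ℕ} (V : Finset (Fin n)) (q : unitInterval)
    {v : Fin n} {W : Finset (Fin n)} (hW : v ∉ W) :
    (bernoulliGraph V q).real {G | ∀ w ∈ W, ¬ G.Adj v w} =
      (1 - (q : ℝ)) ^ (if v ∈ V then (W ∩ V).card else 0) := by
  classical
  have hne : ∀ w ∈ W, v ≠ w := fun w hw h => hW (h ▸ hw)
  have hset : {G : SimpleGraph (Fin n) | ∀ w ∈ W, ¬ G.Adj v w} =
      {G : SimpleGraph (Fin n) | ∀ i ∈ W.image (fun w => s(v, w)), i ∉ G.edgeSet} := by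
    ext G
    simp
  have hinj : Function.Injective fun w : Fin n => s(v, w) := fun a b hab =>
    Sym2.congr_right.1 hab
  have hpair : ∀ w ∈ W, (s(v, w) ∈ pairsIn V ↔ v ∈ V ∧ w ∈ V) := fun w hw => by
    simp [pairsIn, hne w hw]
  rw [hset, bernoulliGraph_real_avoid]
  · rw [Finset.filter_image, Finset.card_image_of_injective _ hinj, Finset.filter_congr hpair]
    split_ifs with hv
    · simp only [hv, true_and, Finset.filter_mem_eq_inter]
    · simp [hv]
  · intro i hi
    obtain ⟨w, hw, rfl⟩ := Finset.mem_image.1 hi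
    simpa using hne w hw

lemma h_nonneg (p : Params) : 0 ≤ h p :=
  sub_nonneg.2 (pow_le_one₀ (sub_nonneg.2 p.2.2.2) (by linarith [p.2.2.1]))

lemma h_le_one (p : Params) : h p ≤ 1 :=
  sub_le_self _ (pow_nonneg (sub_nonneg.2 p.2.2.2) _)

lemma le_h {p : Params} (hp : 2 ≤ p.1) : (p.2 : ℝ) ≤ h p := by
  have := pow_le_of_le_one (sub_nonneg.2 p.2.2.2) (by linarith [p.2.2.1])
    (show p.1 - 1 ≠ 0 by omega)
  unfold h
  linarith

lemma bernoulliGraph_real_uncrossed_le {n : ℕ} (V : Finset (Fin n)) (q : unitInterval)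
    (S : Finset (Fin n)) {u w : Fin n} (hu : u ∈ S) (hw : w ∉ S) (huV : u ∈ V) (hwV : w ∈ V) :
    (bernoulliGraph V q).real (uncrossed S) ≤ 1 - q := by
  classical
  have hne : u ≠ w := fun h => hw (h ▸ hu)
  have key := bernoulliGraph_real_avoid V q {s(u, w)} (by simpa using hne)
  have hmem : s(u, w) ∈ pairsIn V := by
    refine ⟨by simpa using hne, fun x hx => ?_⟩
    rcases Sym2.mem_iff.1 hx with rfl | rfl <;> assumption
  rw [Finset.filter_singleton, if_pos hmem, Finset.card_singleton, pow_one] at key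
  rw [← key]
  refine measureReal_mono fun G hG => ?_
  simpa using hG u hu w hw

lemma bernoulliGraph_real_uncrossed_eq {n : ℕ} (V : Finset (Fin n)) (q : unitInterval)
    (v : Fin n) :
    (bernoulliGraph V q).real (uncrossed {v}) = 1 - h (V.card, q) * (if v ∈ V then 1 else 0) := by
  have hset : uncrossed {v} = {G | ∀ w ∈ Finset.univ.erase v, ¬ G.Adj v w} := by
    ext G
    simp [uncrossed]
  rw [hset, bernoulliGraph_real_star V q (Finset.notMem_erase v _)]
  split_ifs with hv
  · have : Finset.univ.erase v ∩ V = V.erase v := by ext; simp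
    rw [this, Finset.card_erase_of_mem hv]
    simp [h]
  · simp

/-- One of the two events is simply dropped. This loses something only when `V` contains both
vertices, which for a random `V` costs a term of order `x ^ 2 / n ^ 2`. -/
lemma bernoulliGraph_real_uncrossed_inter_le {n : ℕ} (V : Finset (Fin n)) (q : unitInterval)
    (v w : Fin n) :
    (bernoulliGraph V q).real (uncrossed {v} ∩ uncrossed {w}) ≤
      1 - h (V.card, q) * (if v ∈ V then 1 else 0) - h (V.card, q) * (if w ∈ V then 1 else 0) +
        h (V.card, q) * (if v ∈ V ∧ w ∈ V then 1 else 0) := by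
  have hv := bernoulliGraph_real_uncrossed_eq V q v
  have hw := bernoulliGraph_real_uncrossed_eq V q w
  have h1 : (bernoulliGraph V q).real (uncrossed {v} ∩ uncrossed {w}) ≤
      (bernoulliGraph V q).real (uncrossed {v}) := measureReal_mono Set.inter_subset_left
  have h2 : (bernoulliGraph V q).real (uncrossed {v} ∩ uncrossed {w}) ≤
      (bernoulliGraph V q).real (uncrossed {w}) := measureReal_mono Set.inter_subset_right
  have h0 := h_nonneg (V.card, q)
  by_cases hvV : v ∈ V <;> by_cases hwV : w ∈ V <;> simp only [hvV, hwV, if_true, if_false,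
    and_self, and_false, false_and] at hv hw ⊢ <;> linarith

/-- With `a = |S ∩ V|` the bracket equals `a - a (a - 1)`, which is `1` for `a = 1` and at most `0`
otherwise. Only `a = 1` needs an argument: the single vertex of `S ∩ V` must then be isolated inside
`V`. This Bonferroni form is averaged over `V` using one- and two-point inclusion probabilities
only. -/
lemma bernoulliGraph_real_uncrossed_le_of_card {n : ℕ} (V : Finset (Fin n)) (q : unitInterval)
    (S : Finset (Fin n)) :
    (bernoulliGraph V q).real (uncrossed S) ≤
      1 - h (V.card, q) * (∑ v ∈ S, (if v ∈ V then 1 else 0) -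
        ∑ e ∈ S.offDiag, if e.1 ∈ V ∧ e.2 ∈ V then 1 else 0) := by
  have h0 := h_nonneg (V.card, q)
  have hone : (bernoulliGraph V q).real (uncrossed S) ≤ 1 := measureReal_le_one
  have hA : (∑ v ∈ S, if v ∈ V then (1 : ℝ) else 0) = (S ∩ V).card := by
    rw [Finset.sum_boole, Finset.filter_mem_eq_inter]
  have hB : (∑ e ∈ S.offDiag, if e.1 ∈ V ∧ e.2 ∈ V then (1 : ℝ) else 0) =
      ((S ∩ V).card * (S ∩ V).card - (S ∩ V).card : ℕ) := by
    rw [Finset.sum_boole, ← Finset.offDiag_card]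
    congr 2
    ext e
    simp only [Finset.mem_filter, Finset.mem_offDiag, Finset.mem_inter]
    tauto
  rw [hA, hB]
  set a := (S ∩ V).card with ha
  have hle : a ≤ a * a := Nat.le_mul_self a
  push_cast [Nat.cast_sub hle]
  rcases Nat.lt_or_ge 1 a with h2 | h2
  · have : (2 : ℝ) ≤ a := by exact_mod_cast h2
    nlinarith [mul_nonneg h0 (show (0 : ℝ) ≤ a * a - a - a by nlinarith)]
  · interval_cases h3 : a
    · simp [hone]
    · obtain ⟨v, hv⟩ := Finset.card_eq_one.1 ha.symm
      have hvS : v ∈ S ∩ V := by rw [hv]; simp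
      rw [Finset.mem_inter] at hvS
      have hmono : (bernoulliGraph V q).real (uncrossed S) ≤
          (bernoulliGraph V q).real {G | ∀ w ∈ V.erase v, ¬ G.Adj v w} := by
        refine measureReal_mono fun G hG w hw => hG v hvS.1 w fun hwS => ?_
        have : w ∈ S ∩ V := Finset.mem_inter.2 ⟨hwS, Finset.mem_of_mem_erase hw⟩
        rw [hv, Finset.mem_singleton] at this
        exact Finset.ne_of_mem_erase hw this
      rw [bernoulliGraph_real_star V q (Finset.notMem_erase v _), if_pos hvS.2,
        Finset.inter_eq_left.2 (Finset.erase_subset _ _), Finset.card_erase_of_mem hvS.2] at hmono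
      simpa [h] using hmono

/-! ### Averages over uniformly random subsets -/

/-- The mean of `φ V` for a uniformly random subset `V ⊆ [n]` of size `x`. -/
noncomputable def subsetAvg (n x : ℕ) (φ : Finset (Fin n) → ℝ) : ℝ :=
  (∑ V ∈ Finset.powersetCard x Finset.univ, φ V) / (n.choose x : ℝ)

lemma subsetAvg_mono {n x : ℕ} {φ ψ : Finset (Fin n) → ℝ} (hφ : ∀ V, V.card = x → φ V ≤ ψ V) :
    subsetAvg n x φ ≤ subsetAvg n x ψ :=
  div_le_div_of_nonneg_right
    (Finset.sum_le_sum fun V hV => hφ V (Finset.mem_powersetCard.1 hV).2) (by positivity)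

lemma subsetAvg_congr {n x : ℕ} {φ ψ : Finset (Fin n) → ℝ} (hφ : ∀ V, V.card = x → φ V = ψ V) :
    subsetAvg n x φ = subsetAvg n x ψ :=
  le_antisymm (subsetAvg_mono fun V hV => (hφ V hV).le) (subsetAvg_mono fun V hV => (hφ V hV).ge)

lemma subsetAvg_const {n x : ℕ} (hx : x ≤ n) (c : ℝ) : subsetAvg n x (fun _ => c) = c := by
  have : (n.choose x : ℝ) ≠ 0 := by exact_mod_cast (Nat.choose_pos hx).ne'
  simp [subsetAvg, this]

lemma subsetAvg_add {n x : ℕ} (φ ψ : Finset (Fin n) → ℝ) :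
    subsetAvg n x (fun V => φ V + ψ V) = subsetAvg n x φ + subsetAvg n x ψ := by
  simp [subsetAvg, Finset.sum_add_distrib, add_div]

lemma subsetAvg_sub {n x : ℕ} (φ ψ : Finset (Fin n) → ℝ) :
    subsetAvg n x (fun V => φ V - ψ V) = subsetAvg n x φ - subsetAvg n x ψ := by
  simp [subsetAvg, Finset.sum_sub_distrib, sub_div]

lemma subsetAvg_const_mul {n x : ℕ} (c : ℝ) (φ : Finset (Fin n) → ℝ) :
    subsetAvg n x (fun V => c * φ V) = c * subsetAvg n x φ := by
  simp [subsetAvg, ← Finset.mul_sum, mul_div_assoc]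

lemma subsetAvg_sum {n x : ℕ} {ι : Type*} (s : Finset ι) (φ : ι → Finset (Fin n) → ℝ) :
    subsetAvg n x (fun V => ∑ i ∈ s, φ i V) = ∑ i ∈ s, subsetAvg n x (φ i) := by
  simp only [subsetAvg]
  rw [Finset.sum_comm, Finset.sum_div]

lemma subsetAvg_mem {n x : ℕ} (hx : x ≤ n) (v : Fin n) :
    subsetAvg n x (fun V => if v ∈ V then 1 else 0) = x / n := by
  obtain ⟨n, rfl⟩ : ∃ k, n = k + 1 := ⟨n - 1, by have := v.pos; omega⟩
  rw [subsetAvg, Finset.sum_boole]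
  rcases Nat.eq_zero_or_pos x with rfl | hx0
  · simp
  · obtain ⟨x, rfl⟩ : ∃ k, x = k + 1 := ⟨x - 1, by omega⟩
    have hc := Finset.card_filter_powersetCard_subset {v} (Finset.univ : Finset (Fin (n + 1)))
      (x + 1) (Finset.subset_univ _) (by simp)
    simp only [Finset.singleton_subset_iff, Finset.card_univ, Fintype.card_fin,
      Finset.card_singleton, Nat.add_sub_cancel] at hc
    rw [hc, div_eq_div_iff (by exact_mod_cast (Nat.choose_pos hx).ne') (by positivity)]
    have : ((n : ℝ) + 1) * n.choose x = (n + 1).choose (x + 1) * (x + 1) := by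
      exact_mod_cast Nat.add_one_mul_choose_eq n x
    push_cast
    linear_combination this

lemma subsetAvg_mem_mem {n x : ℕ} (hx : x ≤ n) {v w : Fin n} (hvw : v ≠ w) :
    subsetAvg n x (fun V => if v ∈ V ∧ w ∈ V then 1 else 0) =
      x * (x - 1) / (n * (n - 1)) := by
  obtain ⟨n, rfl⟩ : ∃ k, n = k + 2 :=
    ⟨n - 2, by have := v.2; have := w.2; have := Fin.val_ne_of_ne hvw; omega⟩
  rw [subsetAvg, Finset.sum_boole]
  have hsub : ∀ V : Finset (Fin (n + 2)), (v ∈ V ∧ w ∈ V) ↔ {v, w} ⊆ V := fun V => by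
    simp [Finset.insert_subset_iff]
  rcases Nat.lt_or_ge x 2 with hx2 | hx2
  · rw [Finset.filter_eq_empty_iff.2]
    · interval_cases x <;> simp
    · intro V hV hVv
      have := Finset.card_le_card ((hsub V).1 hVv)
      rw [Finset.card_pair hvw, (Finset.mem_powersetCard.1 hV).2] at this
      omega
  · obtain ⟨x, rfl⟩ : ∃ k, x = k + 2 := ⟨x - 2, by omega⟩
    have hc := Finset.card_filter_powersetCard_subset {v, w} (Finset.univ : Finset (Fin (n + 2)))
      (x + 2) (Finset.subset_univ _) (by rw [Finset.card_pair hvw]; omega)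
    rw [Finset.card_pair hvw] at hc
    simp only [Finset.card_univ, Fintype.card_fin, Nat.add_sub_cancel] at hc
    simp only [hsub]
    rw [hc, div_eq_div_iff (by exact_mod_cast (Nat.choose_pos hx).ne')
      (by push_cast; ring_nf; positivity)]
    have h1 := Nat.add_one_mul_choose_eq (n + 1) (x + 1)
    have h2 := Nat.add_one_mul_choose_eq n x
    have h1' : ((n : ℝ) + 2) * ((n + 1).choose (x + 1)) = ((n + 2).choose (x + 2)) * (x + 2) := by
      exact_mod_cast h1
    have h2' : ((n : ℝ) + 1) * (n.choose x) = ((n + 1).choose (x + 1)) * (x + 1) := by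
      exact_mod_cast h2
    push_cast
    linear_combination (n + 2 : ℝ) * h2' + (x + 1 : ℝ) * h1'

/-! ### One layer with given size and density -/

lemma layerGiven_real {n : ℕ} {p : Params} (hp : p.1 ≤ n) (A : Set (SimpleGraph (Fin n))) :
    (layerGiven n p).real A = subsetAvg n p.1 fun V => (bernoulliGraph V p.2).real A := by
  classical
  have hset : {V : Finset (Fin n) | V.card = p.1} =
      ((Finset.powersetCard p.1 Finset.univ : Finset (Finset (Fin n))) : Set _) := by
    ext V
    simp [Finset.mem_powersetCard]
  have hw : ∀ V : Finset (Fin n), uniformOn {V : Finset (Fin n) | V.card = p.1} {V} =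
      if V.card = p.1 then ((n.choose p.1 : ℕ) : ENNReal)⁻¹ else 0 := fun V => by
    rw [hset, ← Finset.coe_singleton, uniformOn_apply_finset]
    split_ifs with hV
    · rw [Finset.inter_singleton_of_mem (by simp [Finset.mem_powersetCard, hV])]
      simp
    · rw [Finset.inter_singleton_of_notMem (by simp [Finset.mem_powersetCard, hV])]
      simp
  rw [measureReal_def, layerGiven, Measure.bind_apply (Set.toFinite _).measurableSet
    (Measurable.of_discrete).aemeasurable, lintegral_fintype, ENNReal.toReal_sum]
  · rw [subsetAvg, Finset.sum_div, ← Finset.sum_subset (Finset.subset_univ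
      (Finset.powersetCard p.1 Finset.univ : Finset (Finset (Fin n))))]
    · refine Finset.sum_congr rfl fun V hV => ?_
      rw [hw, if_pos (Finset.mem_powersetCard.1 hV).2, ENNReal.toReal_mul, ENNReal.toReal_inv,
        ENNReal.toReal_natCast, measureReal_def, div_eq_mul_inv]
    · intro V _ hV
      rw [hw, if_neg (by simpa [Finset.mem_powersetCard] using hV)]
      simp
  · intro V _
    rw [hw]
    refine ENNReal.mul_ne_top (measure_ne_top _ _) ?_
    split_ifs
    · simpa using (Nat.choose_pos hp).ne'
    · simp

/-- The hypothesis matters: for a size above `n` there is no vertex set to choose, and `layerGiven`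
is the zero measure. -/
lemma isProbabilityMeasure_layerGiven {n : ℕ} {p : Params} (hp : p.1 ≤ n) :
    IsProbabilityMeasure (layerGiven n p) := by
  have : (layerGiven n p).real Set.univ = 1 := by
    rw [layerGiven_real hp]
    simpa using subsetAvg_const hp 1
  refine ⟨?_⟩
  rw [measureReal_def] at this
  rwa [ENNReal.toReal_eq_one_iff] at this

lemma layerGiven_real_uncrossed_singleton {n : ℕ} {p : Params} (hp : p.1 ≤ n) (v : Fin n) :
    (layerGiven n p).real (uncrossed {v}) = 1 - p.1 * h p / n := by
  rw [layerGiven_real hp, subsetAvg_congr (ψ := fun V => 1 - h p * (if v ∈ V then 1 else 0)),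
    subsetAvg_sub, subsetAvg_const hp, subsetAvg_const_mul, subsetAvg_mem hp]
  · ring
  · rintro V hV
    rw [bernoulliGraph_real_uncrossed_eq, hV]

lemma pair_density_le {n x : ℕ} (hx : x ≤ n) :
    (x * (x - 1) / (n * (n - 1)) : ℝ) ≤ x ^ 2 / n ^ 2 := by
  rcases Nat.lt_or_ge n 2 with hn | hn
  · have : (n * (n - 1) : ℝ) = 0 := by interval_cases n <;> simp
    rw [this, div_zero]
    positivity
  · have hn' : (2 : ℝ) ≤ n := by exact_mod_cast hn
    have hx' : (x : ℝ) ≤ n := by exact_mod_cast hx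
    have hx0 : (0 : ℝ) ≤ x := by positivity
    rw [div_le_div_iff₀ (by nlinarith) (by positivity)]
    have : 0 ≤ (x : ℝ) * n * (n - x) := by
      have := sub_nonneg.2 hx'
      positivity
    nlinarith

lemma layerGiven_real_uncrossed_inter_le {n : ℕ} {p : Params} (hp : p.1 ≤ n) {v w : Fin n}
    (hvw : v ≠ w) :
    (layerGiven n p).real (uncrossed {v} ∩ uncrossed {w}) ≤
      1 - 2 * (p.1 * h p / n) + p.1 ^ 2 * h p / n ^ 2 := by
  rw [layerGiven_real hp]
  refine (subsetAvg_mono (ψ := fun V => 1 - h p * (if v ∈ V then 1 else 0) -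
      h p * (if w ∈ V then 1 else 0) + h p * (if v ∈ V ∧ w ∈ V then 1 else 0)) ?_).trans ?_
  · rintro V hV
    have := bernoulliGraph_real_uncrossed_inter_le V p.2 v w
    rwa [hV] at this
  · rw [subsetAvg_add, subsetAvg_sub, subsetAvg_sub, subsetAvg_const hp, subsetAvg_const_mul,
      subsetAvg_const_mul, subsetAvg_const_mul, subsetAvg_mem hp, subsetAvg_mem hp,
      subsetAvg_mem_mem hp hvw]
    have := mul_le_mul_of_nonneg_left (pair_density_le hp) (h_nonneg p)
    have e : h p * (p.1 ^ 2 / n ^ 2) = p.1 ^ 2 * h p / n ^ 2 := by ring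
    rw [e] at this
    have e2 : h p * (p.1 / n) = p.1 * h p / n := by ring
    rw [e2]
    linarith

lemma layerGiven_real_uncrossed_le_of_card {n : ℕ} {p : Params} (hp : p.1 ≤ n)
    (S : Finset (Fin n)) :
    (layerGiven n p).real (uncrossed S) ≤
      1 - h p * (S.card * (p.1 / n) - S.card ^ 2 * (p.1 ^ 2 / n ^ 2)) := by
  rw [layerGiven_real hp]
  refine (subsetAvg_mono (ψ := fun V => 1 - h p * (∑ v ∈ S, (if v ∈ V then 1 else 0) -
        ∑ e ∈ S.offDiag, if e.1 ∈ V ∧ e.2 ∈ V then 1 else 0)) ?_).trans ?_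
  · rintro V hV
    have := bernoulliGraph_real_uncrossed_le_of_card V p.2 S
    rwa [hV] at this
  · rw [subsetAvg_sub, subsetAvg_const hp, subsetAvg_const_mul, subsetAvg_sub, subsetAvg_sum,
      subsetAvg_sum]
    gcongr 1 - h p * (?_ - ?_)
    · exact h_nonneg p
    · rw [Finset.sum_congr rfl fun v _ => subsetAvg_mem hp v]
      simp
    · rw [Finset.sum_congr rfl fun e he => subsetAvg_mem_mem hp (Finset.mem_offDiag.1 he).2.2,
        Finset.sum_const, Finset.offDiag_card, nsmul_eq_mul]
      refine (mul_le_mul_of_nonneg_left (pair_density_le hp) (by positivity)).trans ?_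
      refine mul_le_mul_of_nonneg_right ?_ (by positivity)
      rw [pow_two]
      exact_mod_cast Nat.sub_le _ _

/-- If `V` meets both sides of the cut, one potential edge already gives a crossing with probability
at least `q`. The indicator of this event is at least the number of pairs of `S ×ˢ Sᶜ` inside `V`
divided by `x ^ 2`, and the mean of that count is explicit. The constant `1 / 4` comes from `(n - k)
/ (n - 1) ≥ 1 / 2` and `(x - 1) / x ≥ 1 / 2`. -/
lemma layerGiven_real_uncrossed_le_of_two_mul_card_le {n : ℕ} {p : Params} (hp : p.1 ≤ n)
    {S : Finset (Fin n)} (hS : 2 * S.card ≤ n) :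
    (layerGiven n p).real (uncrossed S) ≤
      1 - Set.indicator {p : Params | 2 ≤ p.1} (fun p => (p.2 : ℝ)) p * (S.card / (4 * n)) := by
  by_cases hx : 2 ≤ p.1
  swap
  · have := isProbabilityMeasure_layerGiven hp
    simp [hx, measureReal_le_one]
  rw [Set.indicator_of_mem (by simpa using hx), layerGiven_real hp]
  have hx' : (2 : ℝ) ≤ p.1 := by exact_mod_cast hx
  have hn' : (2 : ℝ) ≤ n := by exact_mod_cast hx.trans hp
  refine (subsetAvg_mono (ψ := fun V => 1 - (p.2 / p.1 ^ 2 : ℝ) *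
    ∑ e ∈ S ×ˢ Sᶜ, if e.1 ∈ V ∧ e.2 ∈ V then 1 else 0) ?_).trans ?_
  · rintro V hV
    by_cases hex : ∃ e ∈ S ×ˢ Sᶜ, e.1 ∈ V ∧ e.2 ∈ V
    · obtain ⟨e, heS, he1, he2⟩ := hex
      rw [Finset.mem_product, Finset.mem_compl] at heS
      refine (bernoulliGraph_real_uncrossed_le V p.2 S heS.1 heS.2 he1 he2).trans ?_
      have hcount : (∑ e ∈ S ×ˢ Sᶜ, if e.1 ∈ V ∧ e.2 ∈ V then (1 : ℝ) else 0) ≤ p.1 ^ 2 := by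
        rw [Finset.sum_boole, pow_two, ← hV]
        norm_cast
        rw [← Finset.card_product]
        refine Finset.card_le_card fun e he => ?_
        exact Finset.mem_product.2 (Finset.mem_filter.1 he).2
      have := mul_le_mul_of_nonneg_left hcount (div_nonneg p.2.2.1 (sq_nonneg (p.1 : ℝ)))
      rw [div_mul_cancel₀ _ (by positivity)] at this
      linarith
    · push Not at hex
      rw [Finset.sum_eq_zero fun e he => if_neg fun h => hex e he h.1 h.2]
      simp
  · rw [subsetAvg_sub, subsetAvg_const hp, subsetAvg_const_mul, subsetAvg_sum,
      Finset.sum_congr rfl fun e he => subsetAvg_mem_mem hp (fun h => by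
        rw [Finset.mem_product, Finset.mem_compl, h] at he
        exact he.2 he.1)]
    rw [Finset.sum_const, Finset.card_product, Finset.card_compl, Fintype.card_fin, nsmul_eq_mul,
      sub_le_sub_iff_left, div_mul_eq_mul_div, mul_div_assoc]
    refine mul_le_mul_of_nonneg_left ?_ p.2.2.1
    have hk : (2 * S.card : ℝ) ≤ n := by exact_mod_cast hS
    rw [Nat.cast_mul, Nat.cast_sub (by omega)]
    set k : ℝ := (S.card : ℝ)
    have hk0 : 0 ≤ k := by positivity
    rw [le_div_iff₀ (by positivity), div_mul_eq_mul_div, mul_div_assoc', div_le_div_iff₀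
      (by positivity) (by nlinarith)]
    have h1 : (n : ℝ) - 1 ≤ 2 * (n - k) := by linarith
    have h2 : (p.1 : ℝ) ≤ 2 * (p.1 - 1) := by linarith
    have h3 : ((n : ℝ) - 1) * p.1 ≤ 2 * (n - k) * (2 * (p.1 - 1)) :=
      mul_le_mul h1 h2 (by linarith) (by linarith)
    have h4 : 0 ≤ k * p.1 * n := by positivity
    nlinarith [mul_le_mul_of_nonneg_left h3 h4]

/-! ### Layers with random parameters -/

lemma layerLaw_real {n : ℕ} {μ : Measure Params} [IsProbabilityMeasure μ]
    (hμ : ∀ᵐ p ∂μ, p.1 ≤ n) (A : Set (SimpleGraph (Fin n))) :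
    (layerLaw n μ).real A = ∫ p, (layerGiven n p).real A ∂μ := by
  have hA : MeasurableSet A := (Set.toFinite _).measurableSet
  rw [measureReal_def, layerLaw, Measure.bind_apply hA (layerKernel n).measurable.aemeasurable]
  simp only [measureReal_def]
  rw [integral_toReal]
  · rfl
  · exact ((Measure.measurable_coe hA).comp (measurable_layerGiven n)).aemeasurable
  · filter_upwards [hμ] with p hp
    have := isProbabilityMeasure_layerGiven hp
    exact measure_lt_top _ _

lemma isProbabilityMeasure_layerLaw {n : ℕ} {μ : Measure Params} [IsProbabilityMeasure μ]
    (hμ : ∀ᵐ p ∂μ, p.1 ≤ n) : IsProbabilityMeasure (layerLaw n μ) := by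
  have h1 : (layerLaw n μ).real Set.univ = 1 := by
    rw [layerLaw_real hμ, integral_congr_ae (g := fun _ => (1 : ℝ))]
    · simp
    · filter_upwards [hμ] with p hp
      have := isProbabilityMeasure_layerGiven hp
      simp
  refine ⟨?_⟩
  rwa [measureReal_def, ENNReal.toReal_eq_one_iff] at h1

lemma measurable_layerGiven_real {n : ℕ} (A : Set (SimpleGraph (Fin n))) :
    Measurable fun p => (layerGiven n p).real A :=
  ((Measure.measurable_coe (Set.toFinite A).measurableSet).comp
    (measurable_layerGiven n)).ennreal_toReal

lemma integrable_layerGiven_real {n : ℕ} {μ : Measure Params} [IsProbabilityMeasure μ]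
    (hμ : ∀ᵐ p ∂μ, p.1 ≤ n) (A : Set (SimpleGraph (Fin n))) :
    Integrable (fun p => (layerGiven n p).real A) μ := by
  refine Integrable.of_bound (measurable_layerGiven_real A).aestronglyMeasurable 1 ?_
  filter_upwards [hμ] with p hp
  have := isProbabilityMeasure_layerGiven hp
  rw [Real.norm_of_nonneg measureReal_nonneg]
  exact measureReal_le_one

/-! ### Unions of independent layers -/

section Affiliation

variable {n m : ℕ} {μ : Fin m → ProbabilityMeasure Params}

lemma measurable_iSup_graph : Measurable fun G : Fin m → SimpleGraph (Fin n) => ⨆ i, G i :=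
  measurable_of_finite _

lemma isProbabilityMeasure_affiliationLaw
    (hμ : ∀ i, ∀ᵐ p ∂(μ i : Measure Params), p.1 ≤ n) :
    IsProbabilityMeasure (affiliationLaw n μ) := by
  have := fun i => isProbabilityMeasure_layerLaw (hμ i)
  exact Measure.isProbabilityMeasure_map measurable_iSup_graph.aemeasurable

lemma affiliationLaw_real_eq_prod (hμ : ∀ i, ∀ᵐ p ∂(μ i : Measure Params), p.1 ≤ n)
    {A : Set (SimpleGraph (Fin n))}
    (hA : ∀ G : Fin m → SimpleGraph (Fin n), (⨆ i, G i) ∈ A ↔ ∀ i, G i ∈ A) :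
    (affiliationLaw n μ).real A = ∏ i, ∫ p, (layerGiven n p).real A ∂(μ i : Measure Params) := by
  have := fun i => isProbabilityMeasure_layerLaw (hμ i)
  have hpre : (fun G : Fin m → SimpleGraph (Fin n) => ⨆ i, G i) ⁻¹' A =
      Set.pi Set.univ fun _ => A := by
    ext G
    simpa using hA G
  rw [affiliationLaw, map_measureReal_apply measurable_iSup_graph (Set.toFinite _).measurableSet,
    hpre, measureReal_def, Measure.pi_pi, ENNReal.toReal_prod]
  exact Finset.prod_congr rfl fun i _ => layerLaw_real (hμ i) A

lemma iSup_mem_uncrossed (S : Finset (Fin n)) (G : Fin m → SimpleGraph (Fin n)) :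
    (⨆ i, G i) ∈ uncrossed S ↔ ∀ i, G i ∈ uncrossed S := by
  simp only [uncrossed, Set.mem_ofPred_eq, SimpleGraph.iSup_adj, not_exists]
  exact ⟨fun h i u hu w hw => h u hu w hw i, fun h u hu w hw i => h i u hu w hw⟩

lemma iSup_mem_uncrossed_inter (S T : Finset (Fin n)) (G : Fin m → SimpleGraph (Fin n)) :
    (⨆ i, G i) ∈ uncrossed S ∩ uncrossed T ↔ ∀ i, G i ∈ uncrossed S ∩ uncrossed T := by
  simp only [Set.mem_inter_iff, iSup_mem_uncrossed, forall_and]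

lemma integrable_of_bound_of_le (hμ : ∀ i, ∀ᵐ p ∂(μ i : Measure Params), p.1 ≤ n)
    {g : Params → ℝ} (hg : Measurable g) {C : ℝ} (hC : ∀ p : Params, p.1 ≤ n → |g p| ≤ C)
    (i : Fin m) : Integrable g (μ i : Measure Params) := by
  refine Integrable.of_bound hg.aestronglyMeasurable C ?_
  filter_upwards [hμ i] with p hp using hC p hp

lemma sum_integral_eq [NeZero m] (hμ : ∀ i, ∀ᵐ p ∂(μ i : Measure Params), p.1 ≤ n)
    {g : Params → ℝ} (hg : Measurable g) {C : ℝ} (hC : ∀ p : Params, p.1 ≤ n → |g p| ≤ C) :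
    ∑ i, ∫ p, g p ∂(μ i : Measure Params) =
      m * ∫ p, g p ∂(averagedLaw μ : Measure Params) := by
  have hm : (m : ℝ) ≠ 0 := by exact_mod_cast NeZero.ne m
  have hav : (averagedLaw μ : Measure Params) =
      (m : ENNReal)⁻¹ • ∑ i, (μ i : Measure Params) := rfl
  rw [hav, integral_smul_measure, integral_finsetSum_measure
    fun i _ => integrable_of_bound_of_le hμ hg hC i]
  simp [hm]

lemma ae_le_averagedLaw [NeZero m] (hμ : ∀ i, ∀ᵐ p ∂(μ i : Measure Params), p.1 ≤ n) :
    ∀ᵐ p ∂(averagedLaw μ : Measure Params), p.1 ≤ n := by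
  have hav : (averagedLaw μ : Measure Params) =
      (m : ENNReal)⁻¹ • ∑ i, (μ i : Measure Params) := rfl
  rw [hav]
  refine Measure.ae_smul_measure ?_ _
  rw [ae_iff, Measure.finsetSum_apply]
  exact Finset.sum_eq_zero fun i _ => ae_iff.1 (hμ i)

lemma integrable_averagedLaw [NeZero m] (hμ : ∀ i, ∀ᵐ p ∂(μ i : Measure Params), p.1 ≤ n)
    {g : Params → ℝ} (hg : Measurable g) {C : ℝ} (hC : ∀ p : Params, p.1 ≤ n → |g p| ≤ C) :
    Integrable g (averagedLaw μ : Measure Params) := by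
  refine Integrable.of_bound hg.aestronglyMeasurable C ?_
  filter_upwards [ae_le_averagedLaw hμ] with p hp using hC p hp

/-- If each community has the property `A` with conditional probability at most `1 - g`, then the
union has it with probability at most `exp (-m 𝔼 g)`. -/
lemma affiliationLaw_real_le_exp [NeZero m]
    (hμ : ∀ i, ∀ᵐ p ∂(μ i : Measure Params), p.1 ≤ n) {A : Set (SimpleGraph (Fin n))}
    (hA : ∀ G : Fin m → SimpleGraph (Fin n), (⨆ i, G i) ∈ A ↔ ∀ i, G i ∈ A)
    {g : Params → ℝ} (hg : Measurable g) {C : ℝ} (hC : ∀ p : Params, p.1 ≤ n → |g p| ≤ C)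
    (hgA : ∀ p : Params, p.1 ≤ n → (layerGiven n p).real A ≤ 1 - g p) :
    (affiliationLaw n μ).real A ≤
      Real.exp (-(m * ∫ p, g p ∂(averagedLaw μ : Measure Params))) := by
  rw [affiliationLaw_real_eq_prod hμ hA, ← sum_integral_eq hμ hg hC, ← Finset.sum_neg_distrib,
    Real.exp_sum]
  refine Finset.prod_le_prod (fun i _ => integral_nonneg fun _ => measureReal_nonneg)
    fun i _ => ?_
  have hint := integrable_of_bound_of_le hμ hg hC i
  have : ∫ p, (layerGiven n p).real A ∂(μ i : Measure Params) ≤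
      ∫ p, (1 - g p) ∂(μ i : Measure Params) := by
    refine integral_mono_ae (integrable_layerGiven_real (hμ i) A)
      ((integrable_const 1).sub hint) ?_
    filter_upwards [hμ i] with p hp using hgA p hp
  rw [integral_sub (integrable_const 1) hint] at this
  simp only [integral_const, probReal_univ, one_smul] at this
  have h2 := Real.add_one_le_exp (-∫ p, g p ∂(μ i : Measure Params))
  linarith

/-! ### Isolation probability of a vertex -/

lemma continuous_h : Continuous h := by
  refine continuous_prod_of_discrete_left.2 fun x => ?_
  change Continuous fun q : unitInterval => 1 - (1 - (q : ℝ)) ^ (x - 1)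
  fun_prop

lemma measurable_fst_mul_h : Measurable fun p : Params => (p.1 : ℝ) * h p :=
  (measurable_from_top.comp measurable_fst).mul continuous_h.measurable

lemma measurable_fst_sq_mul_h : Measurable fun p : Params => (p.1 : ℝ) ^ 2 * h p :=
  ((measurable_from_top.comp measurable_fst).pow_const 2).mul continuous_h.measurable

lemma fst_mul_h_nonneg (p : Params) : 0 ≤ (p.1 : ℝ) * h p :=
  mul_nonneg (Nat.cast_nonneg _) (h_nonneg p)

lemma fst_mul_h_le (p : Params) : (p.1 : ℝ) * h p ≤ p.1 :=
  mul_le_of_le_one_right (Nat.cast_nonneg _) (h_le_one p)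

lemma abs_fst_mul_h_le {p : Params} (hp : p.1 ≤ n) : |(p.1 : ℝ) * h p| ≤ n := by
  rw [abs_of_nonneg (fst_mul_h_nonneg p)]
  exact (fst_mul_h_le p).trans (by exact_mod_cast hp)

lemma abs_fst_sq_mul_h_le {p : Params} (hp : p.1 ≤ n) : |(p.1 : ℝ) ^ 2 * h p| ≤ n ^ 2 := by
  have hp' : (p.1 : ℝ) ≤ n := by exact_mod_cast hp
  rw [abs_of_nonneg (mul_nonneg (sq_nonneg _) (h_nonneg p))]
  exact (mul_le_of_le_one_right (sq_nonneg _) (h_le_one p)).trans (by gcongr)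

/-- From `log (1 - a) ≥ 1 - 1 / (1 - a) = -a - a ^ 2 / (1 - a)` and `1 / (1 - a) ≤ 2`. -/
lemma exp_le_one_sub {a : ℝ} (ha : a ≤ 1 / 2) :
    Real.exp (-a - 2 * a ^ 2) ≤ 1 - a := by
  have h1 : 0 < 1 - a := by linarith
  rw [← Real.le_log_iff_exp_le h1]
  refine le_trans ?_ (Real.one_sub_inv_le_log_of_pos h1)
  rw [sub_eq_add_neg 1, ← sub_nonneg]
  have : 1 + -(1 - a)⁻¹ - (-a - 2 * a ^ 2) = a ^ 2 * (1 - 2 * a) / (1 - a) := by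
    field_simp
    ring
  rw [this]
  exact div_nonneg (mul_nonneg (sq_nonneg a) (by linarith)) h1.le

lemma sq_integral_le {ν : Measure Params} [IsProbabilityMeasure ν] (hν : ∀ᵐ p ∂ν, p.1 ≤ n) :
    (∫ p, (p.1 : ℝ) * h p ∂ν) ^ 2 ≤ ∫ p, (p.1 : ℝ) ^ 2 * h p ∂ν := by
  have hint1 : Integrable (fun p : Params => (p.1 : ℝ) * h p) ν := by
    refine Integrable.of_bound measurable_fst_mul_h.aestronglyMeasurable n ?_
    filter_upwards [hν] with p hp using abs_fst_mul_h_le hp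
  have hint2 : Integrable (fun p : Params => (p.1 : ℝ) ^ 2 * h p) ν := by
    refine Integrable.of_bound measurable_fst_sq_mul_h.aestronglyMeasurable (n ^ 2) ?_
    filter_upwards [hν] with p hp using abs_fst_sq_mul_h_le hp
  set a := ∫ p, (p.1 : ℝ) * h p ∂ν with ha
  -- Nonnegativity of the variance, as the pointwise bound `2 a y - a ^ 2 ≤ y ^ 2`, together with `h
  -- ^ 2 ≤ h`.
  have hle : ∫ p, (2 * a * ((p.1 : ℝ) * h p) - a ^ 2) ∂ν ≤ ∫ p, (p.1 : ℝ) ^ 2 * h p ∂ν := by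
    refine integral_mono ((hint1.const_mul _).sub (integrable_const _)) hint2 fun p => ?_
    have h0 := h_nonneg p
    have h1 := h_le_one p
    have : (p.1 * h p) ^ 2 ≤ (p.1 : ℝ) ^ 2 * h p := by
      rw [mul_pow]
      exact mul_le_mul_of_nonneg_left (by nlinarith) (sq_nonneg _)
    dsimp only
    nlinarith [sq_nonneg (p.1 * h p - a)]
  rw [integral_sub (hint1.const_mul _) (integrable_const _), integral_const_mul] at hle
  simp only [integral_const, probReal_univ, one_smul, ← ha] at hle
  nlinarith

/-- Lower bound for the probability that a given vertex is isolated. -/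
lemma exp_le_affiliationLaw_real_uncrossed [NeZero m]
    (hμ : ∀ i, ∀ᵐ p ∂(μ i : Measure Params), p.1 ≤ n) {D : ℝ}
    (hD : D = m / n ^ 2 * ∫ p, (p.1 : ℝ) ^ 2 * h p ∂(averagedLaw μ : Measure Params))
    (hD4 : D ≤ 1 / 4) (v : Fin n) :
    Real.exp (-(m / n * kappa (averagedLaw μ : Measure Params)) - 2 * D) ≤
      (affiliationLaw n μ).real (uncrossed {v}) := by
  have hn : (0 : ℝ) < n := by exact_mod_cast v.pos
  set a : Fin m → ℝ := fun i => (∫ p, (p.1 : ℝ) * h p ∂(μ i : Measure Params)) / n with ha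
  have ha0 : ∀ i, 0 ≤ a i := fun i =>
    div_nonneg (integral_nonneg fun p => fst_mul_h_nonneg p) hn.le
  have hsum : ∑ i, a i = m / n * kappa (averagedLaw μ : Measure Params) := by
    rw [ha, ← Finset.sum_div, sum_integral_eq hμ measurable_fst_mul_h
      fun p => abs_fst_mul_h_le, kappa]
    ring
  have hsq : ∑ i, a i ^ 2 ≤ D := by
    have : D = ∑ i, (∫ p, (p.1 : ℝ) ^ 2 * h p ∂(μ i : Measure Params)) / n ^ 2 := by
      rw [← Finset.sum_div, sum_integral_eq hμ measurable_fst_sq_mul_h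
        fun p => abs_fst_sq_mul_h_le, hD]
      ring
    rw [this]
    refine Finset.sum_le_sum fun i _ => ?_
    rw [ha, div_pow]
    exact div_le_div_of_nonneg_right (sq_integral_le (hμ i)) (by positivity)
  -- The layers need not be identically distributed, yet none can dominate: each `a i ^ 2` is at
  -- most the whole sum, hence at most `D ≤ 1 / 4`.
  have hhalf : ∀ i, a i ≤ 1 / 2 := fun i => by
    have : a i ^ 2 ≤ 1 / 4 :=
      ((Finset.single_le_sum (fun j _ => sq_nonneg (a j)) (Finset.mem_univ i)).trans hsq).trans hD4
    nlinarith [ha0 i]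
  rw [affiliationLaw_real_eq_prod hμ (iSup_mem_uncrossed {v})]
  calc Real.exp (-(m / n * kappa (averagedLaw μ : Measure Params)) - 2 * D)
      ≤ Real.exp (∑ i, (-a i - 2 * a i ^ 2)) := by
        rw [Real.exp_le_exp, Finset.sum_sub_distrib, Finset.sum_neg_distrib, hsum,
          ← Finset.mul_sum]
        linarith
    _ = ∏ i, Real.exp (-a i - 2 * a i ^ 2) := Real.exp_sum _ _
    _ ≤ ∏ i, ∫ p, (layerGiven n p).real (uncrossed {v}) ∂(μ i : Measure Params) := by
        refine Finset.prod_le_prod (fun i _ => (Real.exp_pos _).le) fun i _ => ?_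
        refine (exp_le_one_sub (hhalf i)).trans (le_of_eq ?_)
        have hint := (integrable_of_bound_of_le hμ measurable_fst_mul_h
          (fun p => abs_fst_mul_h_le) i).div_const (n : ℝ)
        rw [integral_congr_ae (g := fun p : Params => 1 - p.1 * h p / n),
          integral_sub (integrable_const 1) hint, integral_div]
        · simp [ha]
        · filter_upwards [hμ i] with p hp using layerGiven_real_uncrossed_singleton hp v

end Affiliation

/-! ### Second moment method and disconnectedness -/

/-- The second moment method for the number of events that occur. -/
lemma measureReal_le_of_second_moment {Ω ι : Type*} [MeasurableSpace Ω] [Fintype ι]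
    [DecidableEq ι] (ν : Measure Ω) [IsProbabilityMeasure ν] {A : ι → Set Ω} {B : Set Ω}
    (hA : ∀ i, MeasurableSet (A i)) (hB : MeasurableSet B) (hAB : ∀ i, Disjoint (A i) B)
    {L U : ℝ} (hL : 0 < L) (hU : 0 ≤ U) (hι : 0 < Fintype.card ι) (hAL : ∀ i, L ≤ ν.real (A i))
    (hAU : ∀ i j, i ≠ j → ν.real (A i ∩ A j) ≤ U) :
    ν.real B ≤ 1 / (Fintype.card ι * L) + U / L ^ 2 - 1 := by
  set N : ℝ := (Fintype.card ι : ℝ) with hN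
  have hN0 : 0 < N := by rw [hN]; exact_mod_cast hι
  set a : ℝ := ∑ i, ν.real (A i) with ha
  have hNL : N * L ≤ a := by
    have := Finset.sum_le_sum fun i (_ : i ∈ Finset.univ) => hAL i
    simpa [hN] using this
  have ha0 : 0 < a := lt_of_lt_of_le (mul_pos hN0 hL) hNL
  set X : Ω → ℝ := fun ω => ∑ i, (A i).indicator 1 ω with hX
  have hint : ∀ s, MeasurableSet s → Integrable (s.indicator (1 : Ω → ℝ)) ν := fun s hs =>
    (integrable_const (1 : ℝ)).indicator hs
  have hXint : Integrable X ν := integrable_finsetSum _ fun i _ => hint _ (hA i)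
  have hX2 : (fun ω => X ω ^ 2) = fun ω => ∑ i, ∑ j, (A i ∩ A j).indicator (1 : Ω → ℝ) ω := by
    funext ω
    rw [hX, pow_two, Finset.sum_mul_sum]
    refine Finset.sum_congr rfl fun i _ => Finset.sum_congr rfl fun j _ => ?_
    rw [Set.inter_indicator_one]
    rfl
  have hX2int : Integrable (fun ω => X ω ^ 2) ν := by
    rw [hX2]
    exact integrable_finsetSum _ fun i _ => integrable_finsetSum _ fun j _ =>
      hint _ ((hA i).inter (hA j))
  have hEX : ∫ ω, X ω ∂ν = a := by
    rw [hX, integral_finsetSum _ fun i _ => hint _ (hA i)]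
    exact Finset.sum_congr rfl fun i _ => integral_indicator_one (hA i)
  have hEX2 : ∫ ω, X ω ^ 2 ∂ν ≤ a + N ^ 2 * U := by
    rw [hX2, integral_finsetSum _ fun i _ => integrable_finsetSum _ fun j _ =>
      hint _ ((hA i).inter (hA j))]
    have : ∀ i, ∫ ω, ∑ j, (A i ∩ A j).indicator (1 : Ω → ℝ) ω ∂ν ≤ ν.real (A i) + N * U := by
      intro i
      rw [integral_finsetSum _ fun j _ => hint _ ((hA i).inter (hA j)),
        ← Finset.add_sum_erase _ _ (Finset.mem_univ i), integral_indicator_one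
        ((hA i).inter (hA i)), Set.inter_self, add_le_add_iff_left]
      calc ∑ j ∈ Finset.univ.erase i, ∫ ω, (A i ∩ A j).indicator (1 : Ω → ℝ) ω ∂ν
          ≤ ∑ j ∈ Finset.univ.erase i, U := Finset.sum_le_sum fun j hj => by
            rw [integral_indicator_one ((hA i).inter (hA j))]
            exact hAU i j (Finset.ne_of_mem_erase hj).symm
        _ ≤ ∑ _j : ι, U :=
            Finset.sum_le_sum_of_subset_of_nonneg (Finset.erase_subset _ _) fun _ _ _ => hU
        _ = N * U := by simp [hN]
    refine (Finset.sum_le_sum fun i _ => this i).trans (le_of_eq ?_)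
    rw [Finset.sum_add_distrib, ← ha]
    simp only [Finset.sum_const, Finset.card_univ, nsmul_eq_mul, ← hN]
    ring
  -- Chebyshev: no `A i` occurs on `B`, so `X = 0` there and `a ^ 2` times the indicator of `B` is
  -- at most `(X - a) ^ 2`.
  have hBa : a ^ 2 * ν.real B ≤ a + N ^ 2 * U - a ^ 2 := by
    have h1 : ∫ ω, a ^ 2 * B.indicator 1 ω ∂ν ≤ ∫ ω, (X ω ^ 2 - 2 * a * X ω + a ^ 2) ∂ν := by
      refine integral_mono ((hint B hB).const_mul _)
        ((hX2int.sub (hXint.const_mul _)).add (integrable_const _)) fun ω => ?_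
      by_cases hω : ω ∈ B
      · have : X ω = 0 := Finset.sum_eq_zero fun i _ =>
          Set.indicator_of_notMem (fun hi => Set.disjoint_left.1 (hAB i) hi hω) _
        simp [this, hω]
      · simp only [hω, not_false_eq_true, Set.indicator_of_notMem, mul_zero]
        nlinarith [sq_nonneg (X ω - a)]
    have hsub : Integrable (fun ω => X ω ^ 2 - 2 * a * X ω) ν := hX2int.sub (hXint.const_mul _)
    rw [integral_const_mul, integral_indicator_one hB, integral_add hsub (integrable_const _),
      integral_sub hX2int (hXint.const_mul _), integral_const_mul, hEX] at h1
    simp only [integral_const, probReal_univ, one_smul] at h1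
    nlinarith
  have h2 : ν.real B ≤ 1 / a + N ^ 2 * U / a ^ 2 - 1 := by
    rw [← mul_le_mul_iff_right₀ (pow_pos ha0 2)]
    refine hBa.trans (le_of_eq ?_)
    field_simp
  have h3 : 1 / a ≤ 1 / (N * L) := one_div_le_one_div_of_le (mul_pos hN0 hL) hNL
  have h4 : N ^ 2 * U / a ^ 2 ≤ U / L ^ 2 := by
    have : U / L ^ 2 = N ^ 2 * U / (N * L) ^ 2 := by
      field_simp
    rw [this]
    gcongr
  linarith

section Affiliation

variable {n m : ℕ} {μ : Fin m → ProbabilityMeasure Params}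

lemma disjoint_uncrossed_singleton_connected (hn : 2 ≤ n) (v : Fin n) :
    Disjoint (uncrossed {v}) {G : SimpleGraph (Fin n) | G.Connected} := by
  rw [Set.disjoint_left]
  intro G hG hc
  have : Nontrivial (Fin n) := Fin.nontrivial_iff_two_le.2 hn
  obtain ⟨w, hw⟩ := hc.preconnected.exists_adj_of_nontrivial v
  exact hG v (by simp) w (by simpa using hw.ne') hw

/-- Second moment bound for the probability of connectedness. -/
lemma probConnected_le [NeZero m] (hn : 2 ≤ n)
    (hμ : ∀ i, ∀ᵐ p ∂(μ i : Measure Params), p.1 ≤ n) {D : ℝ}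
    (hD : D = m / n ^ 2 * ∫ p, (p.1 : ℝ) ^ 2 * h p ∂(averagedLaw μ : Measure Params))
    (hD4 : D ≤ 1 / 4) :
    probConnected n μ ≤ Real.exp (-lambda n μ + 2 * D) + Real.exp (5 * D) - 1 := by
  have := isProbabilityMeasure_affiliationLaw hμ
  have hn0 : (0 : ℝ) < n := by exact_mod_cast (by omega : 0 < n)
  set s : ℝ := m / n * kappa (averagedLaw μ : Measure Params) with hs
  have hpair : ∀ v w : Fin n, v ≠ w →
      (affiliationLaw n μ).real (uncrossed {v} ∩ uncrossed {w}) ≤ Real.exp (-2 * s + D) := by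
    intro v w hvw
    have hmeas : Measurable fun p : Params => 2 * (p.1 * h p / n) - p.1 ^ 2 * h p / (n : ℝ) ^ 2 :=
      ((measurable_fst_mul_h.div_const _).const_mul _).sub (measurable_fst_sq_mul_h.div_const _)
    refine (affiliationLaw_real_le_exp hμ (iSup_mem_uncrossed_inter {v} {w}) hmeas
      (C := 2 * (n / n) + n ^ 2 / n ^ 2) ?_ ?_).trans (le_of_eq ?_)
    · intro p hp
      refine (abs_sub _ _).trans ?_
      rw [abs_mul, abs_div, abs_div, abs_of_nonneg (zero_le_two (α := ℝ)),
        abs_of_nonneg hn0.le, abs_of_nonneg (sq_nonneg (n : ℝ))]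
      gcongr
      · exact abs_fst_mul_h_le hp
      · exact abs_fst_sq_mul_h_le hp
    · intro p hp
      linarith [layerGiven_real_uncrossed_inter_le hp hvw]
    · have h1 := integrable_averagedLaw hμ measurable_fst_mul_h fun p => abs_fst_mul_h_le
      have h2 := integrable_averagedLaw hμ measurable_fst_sq_mul_h fun p => abs_fst_sq_mul_h_le
      rw [integral_sub ((h1.div_const _).const_mul _) (h2.div_const _), integral_const_mul,
        integral_div, integral_div, hs, hD, kappa]
      congr 1
      ring
  -- With `L = exp (-s - 2 D)` and `U = exp (-2 s + D)`, the ratio `U / L ^ 2` is `exp (5 D)` and `1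
  -- / (n L)` is `exp (-λ + 2 D)`.
  have key := measureReal_le_of_second_moment (affiliationLaw n μ)
    (A := fun v : Fin n => uncrossed {v}) (B := {G | G.Connected})
    (fun v => (Set.toFinite _).measurableSet) (Set.toFinite _).measurableSet
    (disjoint_uncrossed_singleton_connected hn) (Real.exp_pos (-s - 2 * D))
    (Real.exp_pos (-2 * s + D)).le (by simpa using by omega)
    (fun v => exp_le_affiliationLaw_real_uncrossed hμ hD hD4 v) hpair
  refine key.trans (le_of_eq ?_)
  rw [Fintype.card_fin, ← Real.exp_nat_mul, ← Real.exp_sub, one_div]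
  congr 2
  · nth_rewrite 1 [← Real.exp_log hn0]
    rw [← Real.exp_add, ← Real.exp_neg, lambda]
    congr 1
    ring
  · congr 1
    push_cast
    ring

/-! ### Union bound over cuts -/

/-- The vertices reachable from some `u` form one side of an empty cut. Being uncrossed is symmetric
under complement, so the smaller side can be taken. -/
lemma exists_uncrossed_of_not_connected [NeZero n] {G : SimpleGraph (Fin n)}
    (hG : ¬ G.Connected) :
    ∃ S : Finset (Fin n), 1 ≤ S.card ∧ 2 * S.card ≤ n ∧ G ∈ uncrossed S := by
  classical
  have hpre : ¬ G.Preconnected := fun hp => hG ⟨hp⟩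
  simp only [SimpleGraph.Preconnected, not_forall] at hpre
  obtain ⟨u, v, huv⟩ := hpre
  set S : Finset (Fin n) := Finset.univ.filter fun w => G.Reachable u w with hS
  have hSU : G ∈ uncrossed S := by
    intro a ha b hb hab
    simp only [hS, Finset.mem_filter, Finset.mem_univ, true_and] at ha hb
    exact hb (ha.trans hab.reachable)
  have hcard := Finset.card_add_card_compl S
  rw [Fintype.card_fin] at hcard
  have hu : u ∈ S := by simp [hS]
  have hv : v ∈ Sᶜ := by simpa [hS] using huv
  have h1 := Finset.card_pos.2 ⟨u, hu⟩
  have h2 := Finset.card_pos.2 ⟨v, hv⟩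
  by_cases hle : 2 * S.card ≤ n
  · exact ⟨S, h1, hle, hSU⟩
  · refine ⟨Sᶜ, h2, by omega, fun a ha b hb hab => ?_⟩
    rw [Finset.mem_compl] at ha hb
    exact hSU b (not_not.1 hb) a ha hab.symm

lemma one_sub_probConnected_le [NeZero n]
    (hμ : ∀ i, ∀ᵐ p ∂(μ i : Measure Params), p.1 ≤ n) :
    1 - probConnected n μ ≤ ∑ S : Finset (Fin n) with 1 ≤ S.card ∧ 2 * S.card ≤ n,
      (affiliationLaw n μ).real (uncrossed S) := by
  have := isProbabilityMeasure_affiliationLaw hμ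
  rw [probConnected, ← probReal_compl_eq_one_sub (Set.toFinite _).measurableSet]
  refine le_trans (measureReal_mono (fun G hG => ?_) (measure_ne_top _ _)) (measureReal_biUnion_finset_le _ _)
  obtain ⟨S, h1, h2, h3⟩ := exists_uncrossed_of_not_connected hG
  simp only [Set.mem_iUnion, Finset.mem_filter, Finset.mem_univ, true_and]
  exact ⟨S, ⟨h1, h2⟩, h3⟩

end Affiliation

/-! ### The logarithmic moment and its tails -/

/-- The weight `x h(x, q) ln (1 + x)`. -/
noncomputable def logWeight (p : Params) : ℝ := (p.1 : ℝ) * h p * Real.log (1 + p.1)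

/-- The part of `logWeight` that comes from sizes larger than `A`. -/
noncomputable def logWeightTail (A : ℝ) : Params → ℝ :=
  {p : Params | A < p.1}.indicator logWeight

/-- The edge density of a community with at least two vertices. -/
noncomputable def edgeDensity : Params → ℝ :=
  Set.indicator {p : Params | 2 ≤ p.1} (fun p => (p.2 : ℝ))

lemma log_one_add_nat_nonneg (x : ℕ) : 0 ≤ Real.log (1 + x) :=
  Real.log_nonneg (by linarith [(Nat.cast_nonneg x : (0 : ℝ) ≤ x)])

lemma logWeight_nonneg (p : Params) : 0 ≤ logWeight p :=
  mul_nonneg (fst_mul_h_nonneg p) (log_one_add_nat_nonneg p.1)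

lemma logWeight_le {n : ℕ} {p : Params} (hp : p.1 ≤ n) :
    logWeight p ≤ n * Real.log (1 + n) := by
  have hp' : (p.1 : ℝ) ≤ n := by exact_mod_cast hp
  refine mul_le_mul ((fst_mul_h_le p).trans hp') (Real.log_le_log (by positivity) (by linarith))
    (log_one_add_nat_nonneg _) (by positivity)

lemma continuous_logWeight : Continuous logWeight := by
  refine Continuous.mul (Continuous.mul ?_ continuous_h) ?_
  · exact continuous_of_discreteTopology.comp continuous_fst
  · exact (continuous_of_discreteTopology (f := fun x : ℕ => Real.log (1 + x))).comp continuous_fst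

/-- Sizes are discrete, so a condition on the size is clopen. Truncation in the size therefore keeps
test functions continuous, as weak convergence requires. -/
lemma continuous_indicator_fst (s : Set ℕ) {f : Params → ℝ} (hf : Continuous f) :
    Continuous ({p : Params | p.1 ∈ s}.indicator f) :=
  hf.indicator fun p hp => by
    have hs : IsClopen {p : Params | p.1 ∈ s} := (isClopen_discrete s).preimage continuous_fst
    rw [hs.frontier_eq] at hp
    exact hp.elim

lemma continuous_edgeDensity : Continuous edgeDensity :=
  continuous_indicator_fst {x | 2 ≤ x} (by fun_prop)

lemma continuous_logWeightTail (A : ℝ) : Continuous (logWeightTail A) :=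
  continuous_indicator_fst {x : ℕ | A < x} continuous_logWeight

lemma edgeDensity_nonneg (p : Params) : 0 ≤ edgeDensity p :=
  Set.indicator_nonneg (fun p _ => p.2.2.1) p

lemma edgeDensity_le_one (p : Params) : edgeDensity p ≤ 1 :=
  Set.indicator_le' (fun p _ => p.2.2.2) (fun _ _ => zero_le_one) p

lemma edgeDensity_le (p : Params) : edgeDensity p ≤ p.1 * h p := by
  refine Set.indicator_le' (f := fun p : Params => (p.2 : ℝ)) (g := fun p : Params => p.1 * h p)
    (fun p hp => ?_) (fun p _ => fst_mul_h_nonneg p) p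
  have h2 : (2 : ℝ) ≤ p.1 := by exact_mod_cast hp
  nlinarith [le_h hp, h_nonneg p]

lemma log_two_mul_le_logWeight (p : Params) : Real.log 2 * (p.1 * h p) ≤ logWeight p := by
  rcases Nat.eq_zero_or_pos p.1 with h0 | h0
  · simp [logWeight, h0]
  · have h1 : (1 : ℝ) ≤ p.1 := by exact_mod_cast h0
    rw [logWeight, mul_comm]
    exact mul_le_mul_of_nonneg_left (Real.log_le_log two_pos (by linarith)) (fst_mul_h_nonneg p)

lemma logWeightTail_nonneg (A : ℝ) (p : Params) : 0 ≤ logWeightTail A p :=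
  Set.indicator_nonneg (fun p _ => logWeight_nonneg p) p

lemma logWeightTail_le (A : ℝ) (p : Params) : logWeightTail A p ≤ logWeight p :=
  Set.indicator_le_self' (fun p _ => logWeight_nonneg p) p

lemma logWeightTail_anti {A B : ℝ} (hAB : A ≤ B) (p : Params) :
    logWeightTail B p ≤ logWeightTail A p :=
  Set.indicator_le_indicator_of_subset (fun _ hp => lt_of_le_of_lt hAB hp) logWeight_nonneg p

lemma abs_logWeightTail_le {n : ℕ} (A : ℝ) {p : Params} (hp : p.1 ≤ n) :
    |logWeightTail A p| ≤ n * Real.log (1 + n) := by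
  rw [abs_of_nonneg (logWeightTail_nonneg A p)]
  exact (logWeightTail_le A p).trans (logWeight_le hp)

lemma abs_logWeight_le {n : ℕ} {p : Params} (hp : p.1 ≤ n) :
    |logWeight p| ≤ n * Real.log (1 + n) := by
  rw [abs_of_nonneg (logWeight_nonneg p)]
  exact logWeight_le hp

lemma abs_edgeDensity_le (p : Params) : |edgeDensity p| ≤ 1 := by
  rw [abs_of_nonneg (edgeDensity_nonneg p)]
  exact edgeDensity_le_one p

lemma tendsto_integral_of_continuous_of_bound {ν : ℕ → ProbabilityMeasure Params}
    {P : ProbabilityMeasure Params} (hconv : Tendsto ν atTop (𝓝 P)) {g : Params → ℝ}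
    (hg : Continuous g) {C : ℝ} (hC : ∀ p, |g p| ≤ C) :
    Tendsto (fun n => ∫ p, g p ∂(ν n : Measure Params)) atTop
      (𝓝 (∫ p, g p ∂(P : Measure Params))) :=
  ProbabilityMeasure.tendsto_iff_forall_integral_tendsto.1 hconv
    (BoundedContinuousFunction.ofNormedAddCommGroup g hg C hC)

/-- Uniform integrability. At a fixed level `K` the truncated weight is bounded and continuous, so
its integrals converge. Subtracting from the convergent full moments, the tail integrals converge to
that of the limit law, which is small for large `K` by dominated convergence. Tails decrease in the
level, and `A n` eventually exceeds `K`. -/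
lemma tendsto_integral_logWeightTail {ν : ℕ → ProbabilityMeasure Params}
    {P : ProbabilityMeasure Params} (hconv : Tendsto ν atTop (𝓝 P))
    (hint : ∀ n, Integrable logWeight (ν n : Measure Params))
    (hfin : Integrable logWeight (P : Measure Params))
    (hmom : Tendsto (fun n => ∫ p, logWeight p ∂(ν n : Measure Params)) atTop
      (𝓝 (∫ p, logWeight p ∂(P : Measure Params))))
    {A : ℕ → ℝ} (hA : Tendsto A atTop atTop) :
    Tendsto (fun n => ∫ p, logWeightTail (A n) p ∂(ν n : Measure Params)) atTop (𝓝 0) := by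
  have htail : ∀ (Q : ProbabilityMeasure Params) (B : ℝ), Integrable logWeight (Q : Measure Params) →
      Integrable (logWeightTail B) (Q : Measure Params) := fun Q B hQ =>
    hQ.mono' (continuous_logWeightTail B).measurable.aestronglyMeasurable
      (Eventually.of_forall fun p => by
        rw [Real.norm_of_nonneg (logWeightTail_nonneg B p)]
        exact logWeightTail_le B p)
  have hfixed : ∀ K : ℕ, Tendsto (fun n => ∫ p, logWeightTail K p ∂(ν n : Measure Params)) atTop
      (𝓝 (∫ p, logWeightTail K p ∂(P : Measure Params))) := by
    intro K
    have hcont := continuous_logWeight.sub (continuous_logWeightTail K)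
    have hbd : ∀ p, |logWeight p - logWeightTail K p| ≤ K * Real.log (1 + K) := fun p => by
      by_cases hp : p.1 ≤ K
      · have : logWeightTail K p = 0 := Set.indicator_of_notMem (by simpa using hp) _
        rw [this, sub_zero]
        exact abs_logWeight_le hp
      · have : logWeightTail K p = logWeight p := Set.indicator_of_mem (by simpa using hp) _
        rw [this, sub_self, abs_zero]
        exact mul_nonneg (Nat.cast_nonneg _) (log_one_add_nat_nonneg _)
    have hlim := hmom.sub (tendsto_integral_of_continuous_of_bound hconv hcont hbd)
    have hdiff : ∀ Q : ProbabilityMeasure Params, Integrable logWeight (Q : Measure Params) →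
        ∫ p, logWeight p ∂(Q : Measure Params) -
          ∫ p, (logWeight p - logWeightTail K p) ∂(Q : Measure Params) =
            ∫ p, logWeightTail K p ∂(Q : Measure Params) := fun Q hQ => by
      rw [integral_sub hQ (htail Q K hQ), sub_sub_cancel]
    rw [← hdiff P hfin]
    exact hlim.congr fun n => hdiff _ (hint n)
  have hzero : Tendsto (fun K : ℕ => ∫ p, logWeightTail K p ∂(P : Measure Params)) atTop
      (𝓝 0) := by
    have := tendsto_integral_of_dominated_convergence (μ := (P : Measure Params))
      (F := fun K : ℕ => logWeightTail K) (f := fun _ => 0) logWeight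
      (fun K => (continuous_logWeightTail K).measurable.aestronglyMeasurable) hfin
      (fun K => Eventually.of_forall fun p => by
        rw [Real.norm_of_nonneg (logWeightTail_nonneg _ p)]
        exact logWeightTail_le _ p)
      (Eventually.of_forall fun p => by
        refine tendsto_const_nhds.congr' ?_
        filter_upwards [eventually_ge_atTop p.1] with K hK
        exact (Set.indicator_of_notMem (by simpa using hK) _).symm)
    simpa using this
  refine tendsto_order.2 ⟨fun a ha => Eventually.of_forall fun n =>
    ha.trans_le (integral_nonneg fun p => logWeightTail_nonneg _ p), fun ε hε => ?_⟩
  obtain ⟨K, hK⟩ := (hzero.eventually (gt_mem_nhds hε)).exists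
  filter_upwards [(hfixed K).eventually (gt_mem_nhds hK), hA.eventually_ge_atTop (K : ℝ)]
    with n hn hAn
  exact (integral_mono (htail _ _ (hint n)) (htail _ _ (hint n))
    fun p => logWeightTail_anti hAn p).trans_lt hn

/-! ### Cut probabilities for small and large vertex sets -/

section Affiliation

variable {n m : ℕ} {μ : Fin m → ProbabilityMeasure Params}

/-- The gain of a factor `1 / log (1 + A)` on large sizes is the reason for the logarithmic moment.
-/
lemma fst_mul_h_le_of_lt {A : ℝ} (hA : 0 < A) {p : Params} (hp : A < p.1) :
    (p.1 : ℝ) * h p ≤ logWeightTail A p / Real.log (1 + A) := by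
  have hlog : 0 < Real.log (1 + A) := Real.log_pos (by linarith)
  have : logWeightTail A p = logWeight p := Set.indicator_of_mem (by simpa using hp) _
  rw [this, le_div_iff₀ hlog]
  exact mul_le_mul_of_nonneg_left (Real.log_le_log (by linarith) (by linarith))
    (fst_mul_h_nonneg p)

lemma affiliationLaw_real_uncrossed_le_of_large [NeZero m]
    (hμ : ∀ i, ∀ᵐ p ∂(μ i : Measure Params), p.1 ≤ n) {S : Finset (Fin n)}
    (hS : 2 * S.card ≤ n) :
    (affiliationLaw n μ).real (uncrossed S) ≤
      Real.exp (-(m / (4 * n) * ∫ p, edgeDensity p ∂(averagedLaw μ : Measure Params))) ^ S.card := by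
  have := affiliationLaw_real_le_exp hμ (iSup_mem_uncrossed S)
    (g := fun p => edgeDensity p * (S.card / (4 * n)))
    (continuous_edgeDensity.measurable.mul_const _) (C := 1 * (S.card / (4 * n)))
    (fun p _ => by
      rw [abs_mul, abs_of_nonneg (show (0 : ℝ) ≤ S.card / (4 * n) by positivity)]
      exact mul_le_mul_of_nonneg_right (abs_edgeDensity_le p) (by positivity))
    (fun p hp => layerGiven_real_uncrossed_le_of_two_mul_card_le hp hS)
  refine this.trans (le_of_eq ?_)
  rw [← Real.exp_nat_mul, integral_mul_const]
  congr 1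
  ring

/-- For `x ≤ A` the second-order term is absorbed by `x ^ 2 ≤ A x`. For `x > A` the last factor is
nonpositive by `fst_mul_h_le_of_lt`, so the trivial bound `1` suffices. -/
lemma layerGiven_real_uncrossed_le_of_tail {A : ℝ} (hA : 0 < A) {S : Finset (Fin n)}
    (hS : S.card * A ≤ n) {p : Params} (hp : p.1 ≤ n) :
    (layerGiven n p).real (uncrossed S) ≤ 1 - S.card / n * (1 - S.card * A / n) *
      (p.1 * h p - logWeightTail A p / Real.log (1 + A)) := by
  have hlog : 0 < Real.log (1 + A) := Real.log_pos (by linarith)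
  rcases Nat.eq_zero_or_pos n with hn | hn
  · have := isProbabilityMeasure_layerGiven hp
    simp [hn, measureReal_le_one]
  have hn0 : (0 : ℝ) < n := by exact_mod_cast hn
  have hfac : 0 ≤ 1 - S.card * A / n := by
    rw [sub_nonneg, div_le_one hn0]
    exact hS
  have hk : (0 : ℝ) ≤ S.card / n := by positivity
  rcases le_or_gt (p.1 : ℝ) A with hpA | hpA
  · have ht : logWeightTail A p = 0 := Set.indicator_of_notMem (by simpa using hpA) _
    refine (layerGiven_real_uncrossed_le_of_card hp S).trans ?_
    rw [ht, zero_div, sub_zero, sub_le_sub_iff_left]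
    have h1 : 0 ≤ (S.card / n : ℝ) ^ 2 * (p.1 * h p) * (A - p.1) :=
      mul_nonneg (mul_nonneg (sq_nonneg _) (fst_mul_h_nonneg p)) (by linarith)
    have h2 : h p * (S.card * (p.1 / n) - S.card ^ 2 * (p.1 ^ 2 / n ^ 2)) -
        S.card / n * (1 - S.card * A / n) * (p.1 * h p) =
        (S.card / n : ℝ) ^ 2 * (p.1 * h p) * (A - p.1) := by ring
    linarith
  · have := isProbabilityMeasure_layerGiven hp
    refine measureReal_le_one.trans ?_
    have h1 := fst_mul_h_le_of_lt hA hpA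
    have h2 := mul_nonneg (mul_nonneg hk hfac) (sub_nonneg.2 h1)
    linarith

lemma affiliationLaw_real_uncrossed_le_of_small [NeZero m] {A : ℝ} (hA : 0 < A)
    (hμ : ∀ i, ∀ᵐ p ∂(μ i : Measure Params), p.1 ≤ n) {S : Finset (Fin n)}
    (hS : S.card * A ≤ n) :
    (affiliationLaw n μ).real (uncrossed S) ≤
      Real.exp (-(m / n * (1 - S.card * A / n) * (kappa (averagedLaw μ : Measure Params) -
        (∫ p, logWeightTail A p ∂(averagedLaw μ : Measure Params)) / Real.log (1 + A)))) ^
          S.card := by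
  have hlog : 0 < Real.log (1 + A) := Real.log_pos (by linarith)
  have := affiliationLaw_real_le_exp hμ (iSup_mem_uncrossed S)
    (g := fun p => S.card / n * (1 - S.card * A / n) *
      (p.1 * h p - logWeightTail A p / Real.log (1 + A)))
    ((measurable_fst_mul_h.sub
      ((continuous_logWeightTail A).measurable.div_const _)).const_mul _)
    (C := |S.card / n * (1 - S.card * A / n)| *
      (n + n * Real.log (1 + n) / Real.log (1 + A)))
    (fun p hp => by
      rw [abs_mul]
      refine mul_le_mul_of_nonneg_left ((abs_sub _ _).trans ?_) (abs_nonneg _)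
      refine add_le_add (abs_fst_mul_h_le hp) ?_
      rw [abs_div, abs_of_pos hlog]
      exact div_le_div_of_nonneg_right (abs_logWeightTail_le A hp) hlog.le)
    (fun p hp => layerGiven_real_uncrossed_le_of_tail hA hS hp)
  refine this.trans (le_of_eq ?_)
  rw [← Real.exp_nat_mul, integral_const_mul, integral_sub
    (integrable_averagedLaw hμ measurable_fst_mul_h fun p => abs_fst_mul_h_le)
    ((integrable_averagedLaw hμ (continuous_logWeightTail A).measurable
      fun p => abs_logWeightTail_le A).div_const _), integral_div, kappa]
  congr 1
  ring

/-- Grouping the sets by size cancels the binomial coefficients and leaves a geometric series. -/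
lemma sum_geometric_subsets_le {ρ : ℝ} (hρ0 : 0 ≤ ρ) (hρ : ρ ≤ 1 / 2) :
    ∑ S : Finset (Fin n) with 1 ≤ S.card, ρ ^ S.card / n.choose S.card ≤ 2 * ρ := by
  rw [Finset.sum_filter, ← Finset.powerset_univ, Finset.sum_powerset_apply_card
    (fun k => if 1 ≤ k then ρ ^ k / (n.choose k : ℝ) else 0), Finset.card_univ, Fintype.card_fin,
    Finset.sum_range_succ']
  simp only [Nat.le_add_left, if_true, nonpos_iff_eq_zero, one_ne_zero,
    if_false, smul_zero, add_zero, nsmul_eq_mul]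
  calc ∑ k ∈ Finset.range n, (n.choose (k + 1) : ℝ) * (ρ ^ (k + 1) / n.choose (k + 1))
      = ρ * ∑ k ∈ Finset.range n, ρ ^ k := by
        rw [Finset.mul_sum]
        refine Finset.sum_congr rfl fun k hk => ?_
        have : (n.choose (k + 1) : ℝ) ≠ 0 := by
          exact_mod_cast (Nat.choose_pos (Finset.mem_range.1 hk)).ne'
        rw [mul_div_cancel₀ _ this, pow_succ']
    _ ≤ ρ * 2 := by
        refine mul_le_mul_of_nonneg_left ?_ hρ0
        have hlt : ρ < 1 := by linarith
        refine ((summable_geometric_of_lt_one hρ0 hlt).sum_le_tsum _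
          fun _ _ => pow_nonneg hρ0 _).trans ?_
        rw [tsum_geometric_of_lt_one hρ0 hlt, inv_le_comm₀ (by linarith) two_pos]
        linarith
    _ = 2 * ρ := mul_comm _ _

lemma one_sub_probConnected_le_of_geometric [NeZero n]
    (hμ : ∀ i, ∀ᵐ p ∂(μ i : Measure Params), p.1 ≤ n) {ρ : ℝ} (hρ0 : 0 ≤ ρ) (hρ : ρ ≤ 1 / 2)
    (hS : ∀ S : Finset (Fin n), 1 ≤ S.card → 2 * S.card ≤ n →
      n.choose S.card * (affiliationLaw n μ).real (uncrossed S) ≤ ρ ^ S.card) :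
    1 - probConnected n μ ≤ 2 * ρ := by
  refine (one_sub_probConnected_le hμ).trans (le_trans ?_ (sum_geometric_subsets_le (n := n) hρ0 hρ))
  refine (Finset.sum_le_sum (g := fun S => ρ ^ S.card / (n.choose S.card : ℝ))
    fun S hmem => ?_).trans (Finset.sum_le_sum_of_subset_of_nonneg ?_ fun _ _ _ => by positivity)
  · obtain ⟨h1, h2⟩ := (Finset.mem_filter.1 hmem).2
    rw [le_div_iff₀ (by exact_mod_cast Nat.choose_pos (by omega)), mul_comm]
    exact hS S h1 h2
  · exact Finset.monotone_filter_right _ fun S _ hS => hS.1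

/-- From `n.choose k ≤ n ^ k / k!` and `k ^ k / k! ≤ exp k`. -/
lemma choose_le_exp_mul_div_pow {k : ℕ} (hk : 0 < k) :
    (n.choose k : ℝ) ≤ (Real.exp 1 * n / k) ^ k := by
  have hk0 : (0 : ℝ) < k := by exact_mod_cast hk
  refine (Nat.choose_le_pow_div k n).trans ?_
  have h1 := Real.pow_div_factorial_le_exp _ hk0.le k
  have h2 : (0 : ℝ) < (k.factorial : ℝ) := by exact_mod_cast k.factorial_pos
  rw [div_pow, mul_pow, ← Real.exp_nat_mul, mul_one, div_le_div_iff₀ h2 (by positivity)]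
  rw [div_le_iff₀ h2] at h1
  have h3 : (0 : ℝ) ≤ (n : ℝ) ^ k := by positivity
  nlinarith

end Affiliation

/-! ### Quantitative estimates in the two regimes -/

section Affiliation

variable {n m : ℕ} {μ : Fin m → ProbabilityMeasure Params}

lemma integral_edgeDensity_le_kappa [NeZero m]
    (hμ : ∀ i, ∀ᵐ p ∂(μ i : Measure Params), p.1 ≤ n) :
    ∫ p, edgeDensity p ∂(averagedLaw μ : Measure Params) ≤
      kappa (averagedLaw μ : Measure Params) :=
  integral_mono (integrable_averagedLaw hμ continuous_edgeDensity.measurable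
    fun p _ => abs_edgeDensity_le p)
    (integrable_averagedLaw hμ measurable_fst_mul_h fun _ => abs_fst_mul_h_le) edgeDensity_le

lemma integrable_logWeight [NeZero m] (hμ : ∀ i, ∀ᵐ p ∂(μ i : Measure Params), p.1 ≤ n) :
    Integrable logWeight (averagedLaw μ : Measure Params) :=
  integrable_averagedLaw hμ continuous_logWeight.measurable fun _ => abs_logWeight_le

lemma log_two_mul_kappa_le [NeZero m] (hμ : ∀ i, ∀ᵐ p ∂(μ i : Measure Params), p.1 ≤ n) :
    Real.log 2 * kappa (averagedLaw μ : Measure Params) ≤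
      ∫ p, logWeight p ∂(averagedLaw μ : Measure Params) := by
  rw [kappa, ← integral_const_mul]
  exact integral_mono
    ((integrable_averagedLaw hμ measurable_fst_mul_h fun p => abs_fst_mul_h_le).const_mul _)
    (integrable_logWeight hμ) log_two_mul_le_logWeight

lemma fst_sq_mul_h_le (hn : 0 < n) {p : Params} (hp : p.1 ≤ n) :
    (p.1 : ℝ) ^ 2 * h p ≤ √n * (p.1 * h p) + n / Real.log (1 + √n) * logWeightTail (√n) p := by
  have hs : 0 < √(n : ℝ) := Real.sqrt_pos.2 (by exact_mod_cast hn)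
  have hlog : 0 < Real.log (1 + √n) := Real.log_pos (by linarith)
  have hxh := fst_mul_h_nonneg p
  have ht := logWeightTail_nonneg (√n) p
  have hp' : (p.1 : ℝ) ≤ n := by exact_mod_cast hp
  rw [pow_two, mul_assoc]
  rcases le_or_gt (p.1 : ℝ) (√n) with hle | hlt
  · have h1 := mul_le_mul_of_nonneg_right hle hxh
    have h2 : 0 ≤ n / Real.log (1 + √n) * logWeightTail (√n) p := by positivity
    linarith
  · have h1 := mul_le_mul hp' (fst_mul_h_le_of_lt hs hlt) hxh (Nat.cast_nonneg n)
    have h2 : 0 ≤ √n * (p.1 * h p) := by positivity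
    have h3 : n / Real.log (1 + √n) * logWeightTail (√n) p =
      n * (logWeightTail (√n) p / Real.log (1 + √n)) := by ring
    linarith

/-- Sizes are split at `√n` by `fst_sq_mul_h_le`. From `0 ≤ λ` follow `m κ / n ≤ log n` and `m / n ≤
log n / c`. This `log n` cancels against `log (1 + √n) ≥ log n / 2`, leaving the tail integral with
the factor `2 / c`. -/
lemma integral_fst_sq_mul_h_le [NeZero m] (hn : 2 ≤ n)
    (hμ : ∀ i, ∀ᵐ p ∂(μ i : Measure Params), p.1 ≤ n) {c : ℝ} (hc : 0 < c)
    (hκ : c ≤ kappa (averagedLaw μ : Measure Params)) (hlam : 0 ≤ lambda n μ) :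
    m / n ^ 2 * ∫ p, (p.1 : ℝ) ^ 2 * h p ∂(averagedLaw μ : Measure Params) ≤
      Real.log n / √n + 2 / c * ∫ p, logWeightTail (√n) p ∂(averagedLaw μ : Measure Params) := by
  have hn0 : (0 : ℝ) < n := by exact_mod_cast (by omega : 0 < n)
  have hs : 0 < √(n : ℝ) := Real.sqrt_pos.2 hn0
  have hss : √(n : ℝ) * √n = n := Real.mul_self_sqrt hn0.le
  have hL : 0 < Real.log n := Real.log_pos (by exact_mod_cast (by omega : 1 < n))
  have hlog : Real.log n / 2 ≤ Real.log (1 + √n) := by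
    rw [← Real.log_sqrt hn0.le]
    exact Real.log_le_log hs (by linarith)
  have hlog0 : 0 < Real.log (1 + √n) := by linarith
  set κ := kappa (averagedLaw μ : Measure Params) with hκdef
  set F := ∫ p, logWeightTail (√n) p ∂(averagedLaw μ : Measure Params) with hF
  have hF0 : 0 ≤ F := integral_nonneg fun p => logWeightTail_nonneg _ p
  have hM : m / n * κ ≤ Real.log n := by
    rw [lambda] at hlam
    linarith
  have hmn : (m / n : ℝ) ≤ Real.log n / c := by
    rw [le_div_iff₀ hc]
    exact (mul_le_mul_of_nonneg_left hκ (by positivity)).trans hM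
  have hint : ∫ p, (p.1 : ℝ) ^ 2 * h p ∂(averagedLaw μ : Measure Params) ≤
      √n * κ + n / Real.log (1 + √n) * F := by
    have i1 := integrable_averagedLaw hμ measurable_fst_mul_h fun p => abs_fst_mul_h_le
    have i2 := integrable_averagedLaw hμ (continuous_logWeightTail √n).measurable
      fun p => abs_logWeightTail_le √n
    rw [hκdef, hF, kappa, ← integral_const_mul, ← integral_const_mul,
      ← integral_add (i1.const_mul _) (i2.const_mul _)]
    refine integral_mono_ae (integrable_averagedLaw hμ measurable_fst_sq_mul_h
      fun p => abs_fst_sq_mul_h_le) ((i1.const_mul _).add (i2.const_mul _)) ?_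
    filter_upwards [ae_le_averagedLaw hμ] with p hp using fst_sq_mul_h_le (by omega) hp
  refine (mul_le_mul_of_nonneg_left hint (by positivity)).trans ?_
  have e1 : (m / n ^ 2 * (√n * κ + n / Real.log (1 + √n) * F) : ℝ) =
      m / n * κ / √n + m / n * (F / Real.log (1 + √n)) := by
    have hdiv : √(n : ℝ) / n = 1 / √n := by
      rw [div_eq_div_iff hn0.ne' hs.ne', hss, one_mul]
    calc (m / n ^ 2 * (√n * κ + n / Real.log (1 + √n) * F) : ℝ)
        = m / n * κ * (√n / n) + m / n * (n / n) * (F / Real.log (1 + √n)) := by ring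
      _ = _ := by rw [hdiv, div_self hn0.ne']; ring
  rw [e1]
  have e2 : m / n * κ / √n ≤ Real.log n / √n := by gcongr
  have e3 : m / n * (F / Real.log (1 + √n)) ≤ Real.log n / c * (F / (Real.log n / 2)) := by
    gcongr
  have e4 : Real.log n / c * (F / (Real.log n / 2)) = 2 / c * F := by
    field_simp
  linarith

/-- Quantitative connectivity: with `n ^ δ` as the truncation level, every vertex set of size at
most `n ^ (1 - 2 δ)` is handled by the expected degree, and the larger ones by the single edges. -/
lemma one_sub_probConnected_le_exp [NeZero m] (hn : 2 ≤ n)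
    (hμ : ∀ i, ∀ᵐ p ∂(μ i : Measure Params), p.1 ≤ n) {c K δ η : ℝ} (hc : 0 < c) (hK : 0 < K)
    (hδ : δ = c / (16 * K))
    (hcn : c ≤ ∫ p, edgeDensity p ∂(averagedLaw μ : Measure Params))
    (hκK : kappa (averagedLaw μ : Measure Params) ≤ K) (hlam : lambda n μ ≤ 0)
    (hη : η = Real.exp (-(δ * Real.log n)) +
      (∫ p, logWeightTail (Real.exp (δ * Real.log n)) p ∂(averagedLaw μ : Measure Params)) /
        (c * δ * Real.log n))
    (hη2 : η ≤ 1 / 2) (hηL : η * Real.log n ≤ 1) {ρ : ℝ} (hρ : ρ ≤ 1 / 2)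
    (hρ1 : Real.exp (1 + lambda n μ / 2) ≤ ρ)
    (hρ2 : Real.exp (1 - c / (8 * K) * Real.log n) ≤ ρ) :
    1 - probConnected n μ ≤ 2 * ρ := by
  have : NeZero n := ⟨by omega⟩
  have hn0 : (0 : ℝ) < n := by exact_mod_cast (by omega : 0 < n)
  have hL : 0 < Real.log n := Real.log_pos (by exact_mod_cast (by omega : 1 < n))
  have hδ0 : 0 < δ := by rw [hδ]; positivity
  set L := Real.log n with hLdef
  set A := Real.exp (δ * L) with hA
  set a := Real.exp (-(δ * L)) with ha
  have hA0 : 0 < A := Real.exp_pos _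
  have ha0 : 0 < a := Real.exp_pos _
  have haA : a * A = 1 := by rw [ha, hA, ← Real.exp_add]; simp
  set κ := kappa (averagedLaw μ : Measure Params) with hκ
  set F := ∫ p, logWeightTail A p ∂(averagedLaw μ : Measure Params) with hF
  have hF0 : 0 ≤ F := integral_nonneg fun p => logWeightTail_nonneg _ p
  have hcκ : c ≤ κ := hcn.trans (integral_edgeDensity_le_kappa hμ)
  have hM : m / n * κ = L - lambda n μ := by rw [lambda]; ring
  have hmn0 : (0 : ℝ) ≤ m / n := by positivity
  refine one_sub_probConnected_le_of_geometric hμ ((Real.exp_pos _).le.trans hρ1) hρ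
    fun S hS1 hS2 => ?_
  have hk0 : (0 : ℝ) < S.card := by exact_mod_cast hS1
  -- Here `A = n ^ δ` and `a = n ^ (-δ)`, so the threshold is `n ^ (1 - 2 δ)`. Below it the
  -- correction `|S| A / n` is at most `a`.
  rcases le_or_gt (S.card : ℝ) (n * a ^ 2) with hsmall | hlarge
  · have hSA : S.card * A ≤ n * a := by
      calc S.card * A ≤ n * a ^ 2 * A := by gcongr
        _ = n * a * (a * A) := by ring
        _ = n * a := by rw [haA, mul_one]
    have ha1 : a ≤ 1 := Real.exp_le_one_iff.2 (neg_nonpos.2 (mul_nonneg hδ0.le hL.le))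
    have hSn : S.card * A ≤ n := hSA.trans (mul_le_of_le_one_right hn0.le ha1)
    have hchoose : (n.choose S.card : ℝ) ≤ Real.exp L ^ S.card := by
      rw [hLdef, Real.exp_log hn0]
      exact_mod_cast Nat.choose_le_pow n S.card
    refine (mul_le_mul hchoose (affiliationLaw_real_uncrossed_le_of_small hA0 hμ hSn)
      measureReal_nonneg (by positivity)).trans ?_
    rw [← mul_pow, ← Real.exp_add]
    refine pow_le_pow_left₀ (Real.exp_pos _).le ((Real.exp_le_exp.2 ?_).trans hρ1) _
    have hlogA : δ * L ≤ Real.log (1 + A) := by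
      rw [Real.le_log_iff_exp_le (by linarith)]
      linarith
    set y := S.card * A / n with hy
    have hy0 : 0 ≤ y := by positivity
    have hya : y ≤ a := by
      rw [hy, div_le_iff₀ hn0, mul_comm a]
      exact hSA
    set f := F / Real.log (1 + A) with hf
    have hf0 : 0 ≤ f := div_nonneg hF0 ((mul_pos hδ0 hL).le.trans hlogA)
    have hfle : f ≤ F / (δ * L) := div_le_div_of_nonneg_left hF0 (mul_pos hδ0 hL) hlogA
    have hprod : κ - a * κ - f ≤ (1 - y) * (κ - f) := by
      have h1 : y * κ ≤ a * κ := mul_le_mul_of_nonneg_right hya (hc.le.trans hcκ)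
      have h2 := mul_nonneg hy0 hf0
      nlinarith
    -- Replacing `c` by `κ` bounds the error by a multiple of `m κ / n = L - λ`, so it stays
    -- proportional to the main term however negative `λ` is.
    have hmf : m / n * f ≤ (L - lambda n μ) * (F / (c * δ * L)) := by
      calc m / n * f ≤ m / n * (F / (δ * L)) := by gcongr
        _ = m / n * c * (F / (c * δ * L)) := by field_simp
        _ ≤ m / n * κ * (F / (c * δ * L)) := by gcongr
        _ = _ := by rw [hM]
    have hmain := mul_le_mul_of_nonneg_left hprod hmn0
    have e1 : m / n * (κ - a * κ - f) = m / n * κ - a * (m / n * κ) - m / n * f := by ring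
    rw [e1, hM] at hmain
    have e2 : m / n * (1 - y) * (κ - f) = m / n * ((1 - y) * (κ - f)) := by ring
    rw [e2]
    -- The exponent is at most `L - (1 - η) (L - λ) = η L + (1 - η) λ`, which is at most `1 + λ / 2`
    -- because `η L ≤ 1`, `η ≤ 1 / 2` and `λ ≤ 0`.
    have e3 : (L - lambda n μ) * η = a * (L - lambda n μ) +
        (L - lambda n μ) * (F / (c * δ * L)) := by rw [hη]; ring
    have e4 : 0 ≤ -lambda n μ * (1 / 2 - η) := mul_nonneg (by linarith) (by linarith)
    linarith
  · have hchoose : (n.choose S.card : ℝ) ≤ Real.exp (1 + 2 * (δ * L)) ^ S.card := by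
      refine (choose_le_exp_mul_div_pow hS1).trans (pow_le_pow_left₀ (by positivity) ?_ _)
      have : Real.exp (1 + 2 * (δ * L)) = Real.exp 1 * A ^ 2 := by
        rw [Real.exp_add, hA, ← Real.exp_nat_mul]
        norm_num
      rw [this, mul_div_assoc]
      refine mul_le_mul_of_nonneg_left ?_ (Real.exp_pos _).le
      rw [div_le_iff₀ hk0]
      calc (n : ℝ) = A ^ 2 * (n * a ^ 2) := by
            linear_combination (-(n : ℝ) * (a * A + 1)) * haA
        _ ≤ A ^ 2 * S.card := by gcongr
    refine (mul_le_mul hchoose (affiliationLaw_real_uncrossed_le_of_large hμ hS2)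
      measureReal_nonneg (by positivity)).trans ?_
    rw [← mul_pow, ← Real.exp_add]
    refine pow_le_pow_left₀ (Real.exp_pos _).le ((Real.exp_le_exp.2 ?_).trans hρ2) _
    have hmK : L ≤ m / n * K := by
      have := mul_le_mul_of_nonneg_left hκK hmn0
      linarith
    set C := ∫ p, edgeDensity p ∂(averagedLaw μ : Measure Params)
    have h1 : c * L / (4 * K) ≤ m / (4 * n) * C := by
      calc c * L / (4 * K) ≤ c * (m / n * K) / (4 * K) := by gcongr
        _ = m / (4 * n) * c := by field_simp
        _ ≤ _ := by gcongr
    -- The choice `δ = c / (16 K)` makes the entropy `2 δ L` exactly half of the lower bound `c L /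
    -- (4 K)` for the decay exponent.
    have h2 : 2 * (δ * L) = c * L / (8 * K) := by rw [hδ]; field_simp; norm_num
    have h3 : c * L / (4 * K) = 2 * (c * L / (8 * K)) := by field_simp; norm_num
    have h4 : c / (8 * K) * L = c * L / (8 * K) := by ring
    linarith

end Affiliation

/-! ### Passage to the limit -/

lemma tendsto_log_natCast_atTop : Tendsto (fun n : ℕ => Real.log n) atTop atTop :=
  Real.tendsto_log_atTop.comp tendsto_natCast_atTop_atTop

lemma tendsto_log_div_sqrt : Tendsto (fun n : ℕ => Real.log n / √n) atTop (𝓝 0) := by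
  have h1 := (isLittleO_log_rpow_atTop (r := 1 / 2) (by norm_num)).tendsto_div_nhds_zero
  refine (h1.comp tendsto_natCast_atTop_atTop).congr fun n => ?_
  simp [Real.sqrt_eq_rpow]

lemma tendsto_exp_neg_mul_mul {δ : ℝ} (hδ : 0 < δ) {L : ℕ → ℝ} (hL : Tendsto L atTop atTop) :
    Tendsto (fun n => Real.exp (-(δ * L n)) * L n) atTop (𝓝 0) := by
  have h1 := (Real.tendsto_pow_mul_exp_neg_atTop_nhds_zero 1).comp (hL.const_mul_atTop hδ)
  have h2 := h1.const_mul δ⁻¹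
  rw [mul_zero] at h2
  refine h2.congr fun n => ?_
  simp only [Function.comp_apply, pow_one]
  field_simp

section Limit

variable {m : ℕ → ℕ} [∀ n, NeZero (m n)] {μ : (n : ℕ) → Fin (m n) → ProbabilityMeasure Params}

theorem tendsto_probConnected_zero (hμ : ∀ n i, ∀ᵐ p ∂(μ n i : Measure Params), p.1 ≤ n)
    {c : ℝ} (hc : 0 < c)
    (hκ : ∀ᶠ n in atTop, c ≤ kappa (averagedLaw (μ n) : Measure Params))
    (htail : ∀ A : ℕ → ℝ, Tendsto A atTop atTop → Tendsto (fun n =>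
      ∫ p, logWeightTail (A n) p ∂(averagedLaw (μ n) : Measure Params)) atTop (𝓝 0))
    (hlam : Tendsto (fun n => lambda n (μ n)) atTop atTop) :
    Tendsto (fun n => probConnected n (μ n)) atTop (𝓝 0) := by
  set D : ℕ → ℝ := fun n => m n / n ^ 2 *
    ∫ p, (p.1 : ℝ) ^ 2 * h p ∂(averagedLaw (μ n) : Measure Params) with hD
  have hD0 : ∀ n, 0 ≤ D n := fun n => mul_nonneg (by positivity)
    (integral_nonneg fun p => mul_nonneg (sq_nonneg _) (h_nonneg p))
  have hDlim : Tendsto D atTop (𝓝 0) := by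
    have hsqrt : Tendsto (fun n : ℕ => √(n : ℝ)) atTop atTop :=
      Real.tendsto_sqrt_atTop.comp tendsto_natCast_atTop_atTop
    have hb := tendsto_log_div_sqrt.add ((htail _ hsqrt).const_mul (2 / c))
    rw [mul_zero, add_zero] at hb
    refine squeeze_zero' (Eventually.of_forall hD0) ?_ hb
    filter_upwards [hκ, hlam.eventually_ge_atTop 0, eventually_ge_atTop 2] with n h1 h2 h3
    exact integral_fst_sq_mul_h_le h3 (hμ n) hc h1 h2
  have hbound : Tendsto (fun n => Real.exp (-lambda n (μ n) + 2 * D n) + Real.exp (5 * D n) - 1)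
      atTop (𝓝 0) := by
    have h1 : Tendsto (fun n => -lambda n (μ n) + 2 * D n) atTop atBot :=
      (tendsto_neg_atTop_atBot.comp hlam).atBot_add (hDlim.const_mul 2)
    have h2 := (Real.tendsto_exp_atBot.comp h1).add
      ((Real.continuous_exp.tendsto _).comp (hDlim.const_mul 5))
    simpa using h2.sub_const 1
  refine squeeze_zero' (Eventually.of_forall fun n => measureReal_nonneg) ?_ hbound
  filter_upwards [hDlim.eventually_le_const (show (0 : ℝ) < 1 / 4 by norm_num),
    eventually_ge_atTop 2] with n h1 h2
  exact probConnected_le h2 (hμ n) rfl h1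

theorem tendsto_probConnected_one (hμ : ∀ n i, ∀ᵐ p ∂(μ n i : Measure Params), p.1 ≤ n)
    {c K : ℝ} (hc : 0 < c) (hK : 0 < K)
    (hcn : ∀ᶠ n in atTop, c ≤ ∫ p, edgeDensity p ∂(averagedLaw (μ n) : Measure Params))
    (hκK : ∀ᶠ n in atTop, kappa (averagedLaw (μ n) : Measure Params) ≤ K)
    (htail : ∀ A : ℕ → ℝ, Tendsto A atTop atTop → Tendsto (fun n =>
      ∫ p, logWeightTail (A n) p ∂(averagedLaw (μ n) : Measure Params)) atTop (𝓝 0))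
    (hlam : Tendsto (fun n => lambda n (μ n)) atTop atBot) :
    Tendsto (fun n => probConnected n (μ n)) atTop (𝓝 1) := by
  set δ := c / (16 * K) with hδ
  have hδ0 : 0 < δ := by positivity
  have hL := tendsto_log_natCast_atTop
  have hδL := hL.const_mul_atTop hδ0
  have hF := htail _ (Real.tendsto_exp_atTop.comp hδL)
  set F : ℕ → ℝ := fun n => ∫ p, logWeightTail (Real.exp (δ * Real.log n)) p
    ∂(averagedLaw (μ n) : Measure Params) with hFdef
  set η : ℕ → ℝ := fun n => Real.exp (-(δ * Real.log n)) + F n / (c * δ * Real.log n) with hη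
  -- Not only `η` but `η log n` must vanish: the factor `1 / log n` in front of the tail integral
  -- compensates exactly, and the tail itself tends to `0`.
  have hηL : Tendsto (fun n : ℕ => η n * Real.log n) atTop (𝓝 0) := by
    have h1 := (tendsto_exp_neg_mul_mul hδ0 hL).add (hF.div_const (c * δ))
    rw [zero_div, add_zero] at h1
    refine h1.congr' ?_
    filter_upwards [hL.eventually_gt_atTop 0] with n hn
    simp only [hη, Function.comp_apply]
    rw [add_mul, add_right_inj]
    field_simp
    rfl
  have hη0 : Tendsto η atTop (𝓝 0) := by
    refine (hηL.div_atTop hL).congr' ?_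
    filter_upwards [hL.eventually_gt_atTop 0] with n hn
    rw [mul_div_cancel_right₀ _ hn.ne']
  set ρ : ℕ → ℝ := fun n => Real.exp (1 + lambda n (μ n) / 2) +
    Real.exp (1 - c / (8 * K) * Real.log n) with hρ
  have hρ0 : Tendsto ρ atTop (𝓝 0) := by
    have h1 : Tendsto (fun n => 1 + lambda n (μ n) / 2) atTop atBot :=
      tendsto_atBot_add_const_left _ _ (hlam.atBot_div_const two_pos)
    have h2 : Tendsto (fun n : ℕ => 1 - c / (8 * K) * Real.log n) atTop atBot :=
      tendsto_atBot_add_const_left _ 1 (tendsto_neg_atTop_atBot.comp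
        (hL.const_mul_atTop (show 0 < c / (8 * K) by positivity)))
    simpa using (Real.tendsto_exp_atBot.comp h1).add (Real.tendsto_exp_atBot.comp h2)
  have hlow : ∀ᶠ n in atTop, 1 - 2 * ρ n ≤ probConnected n (μ n) := by
    filter_upwards [hcn, hκK, hlam.eventually_le_atBot 0, eventually_ge_atTop 2,
      hη0.eventually_le_const (show (0 : ℝ) < 1 / 2 by norm_num),
      hηL.eventually_le_const zero_lt_one,
      hρ0.eventually_le_const (show (0 : ℝ) < 1 / 2 by norm_num)] with n h1 h2 h3 h4 h5 h6 h7
    have := one_sub_probConnected_le_exp h4 (hμ n) hc hK hδ h1 h2 h3 rfl h5 h6 h7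
      (le_add_of_nonneg_right (Real.exp_pos _).le) (le_add_of_nonneg_left (Real.exp_pos _).le)
    linarith
  have hlim : Tendsto (fun n => 1 - 2 * ρ n) atTop (𝓝 1) := by
    simpa using (hρ0.const_mul 2).const_sub 1
  refine tendsto_of_tendsto_of_tendsto_of_le_of_le' hlim tendsto_const_nhds hlow
    (Eventually.of_forall fun n => ?_)
  have := isProbabilityMeasure_affiliationLaw (hμ n)
  exact measureReal_le_one

end Limit

end CommunityAffiliation

theorem theorem1 (m : ℕ → ℕ) [∀ n, NeZero (m n)] (hm : Tendsto m atTop atTop)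
    (μ : (n : ℕ) → Fin (m n) → ProbabilityMeasure Params)
    (hμ : ∀ n i, ∀ᵐ p ∂(μ n i : Measure Params), p.1 ≤ n)
    (P : ProbabilityMeasure Params)
    (hconv : Tendsto (fun n => averagedLaw (μ n)) atTop (𝓝 P))
    (hpos : 0 < ∫ p, Set.indicator {p : Params | 2 ≤ p.1} (fun p => (p.2 : ℝ)) p
      ∂(P : Measure Params))
    (hfin : Integrable (fun p : Params => (p.1 : ℝ) * h p * Real.log (1 + p.1))
      (P : Measure Params))
    (hmom : Tendsto
      (fun n => ∫ p, (p.1 : ℝ) * h p * Real.log (1 + p.1) ∂(averagedLaw (μ n) : Measure Params))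
      atTop (𝓝 (∫ p, (p.1 : ℝ) * h p * Real.log (1 + p.1) ∂(P : Measure Params)))) :
    (Tendsto (fun n => lambda n (μ n)) atTop atTop →
      Tendsto (fun n => probConnected n (μ n)) atTop (𝓝 0)) ∧
    (Tendsto (fun n => lambda n (μ n)) atTop atBot →
      Tendsto (fun n => probConnected n (μ n)) atTop (𝓝 1)) := by

  have hint : ∀ n, Integrable logWeight (averagedLaw (μ n) : Measure Params) :=
    fun n => integrable_logWeight (hμ n)
  have htail : ∀ A : ℕ → ℝ, Tendsto A atTop atTop → Tendsto (fun n =>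
      ∫ p, logWeightTail (A n) p ∂(averagedLaw (μ n) : Measure Params)) atTop (𝓝 0) :=
    fun A hA => tendsto_integral_logWeightTail hconv hint hfin hmom hA
  -- The limiting mean edge density is positive and its integrand is bounded and continuous, so `c₀
  -- / 2` is eventually a lower bound; it also bounds `κ` from below.
  set c₀ := ∫ p, edgeDensity p ∂(P : Measure Params) with hc₀
  have hc₀pos : 0 < c₀ := hpos
  have hc : 0 < c₀ / 2 := by positivity
  have hcn : ∀ᶠ n in atTop,
      c₀ / 2 ≤ ∫ p, edgeDensity p ∂(averagedLaw (μ n) : Measure Params) :=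
    (tendsto_integral_of_continuous_of_bound hconv continuous_edgeDensity
      abs_edgeDensity_le).eventually_const_le (half_lt_self hc₀pos)
  set R := ∫ p, logWeight p ∂(P : Measure Params) with hR
  have hR0 : 0 ≤ R := integral_nonneg logWeight_nonneg
  have hlog2 : 0 < Real.log 2 := Real.log_pos one_lt_two
  -- `κ` is bounded through the convergent logarithmic moment, since `log (1 + x) ≥ log 2` for `x ≥
  -- 1`.
  have hκK : ∀ᶠ n in atTop,
      kappa (averagedLaw (μ n) : Measure Params) ≤ (R + 1) / Real.log 2 := by
    filter_upwards [Tendsto.eventually_le_const (lt_add_one R) hmom] with n hn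
    rw [le_div_iff₀ hlog2, mul_comm]
    exact (log_two_mul_kappa_le (hμ n)).trans hn
  exact ⟨tendsto_probConnected_zero hμ hc
    (hcn.mono fun n hn => hn.trans (integral_edgeDensity_le_kappa (hμ n))) htail,
    tendsto_probConnected_one hμ hc (by positivity) hcn hκK htail⟩
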